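/- **Setting.** Let $\mathscr C$ be either the category $\mathrm{Ab}^{\mathrm A}$ of Banach abelian groups (abelian groups with a complete norm) and bounded homomorphisms, or its full subcategory $\mathrm{Ab}^{\mathrm{nA}}$ of ultrametric ones. For a commutative Banach ring $A$ in $\mathscr C$, let $\mathrm{Mod}_{\mathscr C}(A)$ be the category of Banach $A$-modules in $\mathscr C$ (complete normed $A$-modules $M$, ultrametric if $\mathscr C=\mathrm{Ab}^{\mathrm{nA}}$, with $\|am\|\le C\|a\|\,\|m\|$ for some constant $C$) and bounded $A$-linear maps. The completed tensor product $M\widehat\otimes_A N$ is the completion of $M\otimes_A N$ for the seminorm $t\mapsto\inf\sum_i\|m_i\|\,\|n_i\|$ (resp. $\inf\max_i\|m_i\|\,\|n_i\|$ if $\mathscr C=\mathrm{Ab}^{\mathrm{nA}}$), the infimum being over all expressions $t=\sum_i m_i\otimes n_i$. A sequence $M\xrightarrow{f}N\xrightarrow{g}P$ is strictly exact at $N$ if $\overline{f(M)}=\ker g$ and $f$ is strict, i.e. $M/\ker f\to\overline{f(M)}$ is an isomorphism; a morphism of complexes is a quasi-isomorphism if its mapping cone is strictly exact in every degree; and $\mathrm{Der}^-_{\mathscr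 C}(A)$ is the localization of the homotopy category of bounded above complexes in $\mathrm{Mod}_{\mathscr C}(A)$ at the quasi-isomorphisms. The derived tensor product is $M\widehat\otimes^{\mathbb L}_A N=\mathrm{Tot}(P(M)\widehat\otimes_A P(N))$, where $P(M)$ is the functorial projective resolution $\cdots\to\ell(Z_2,A)\to\ell(Z_1,A)\to\ell(Z_0,A)$ with $Z_0=M$ and $Z_{n+1}=\ker(\ell(Z_n,A)\to Z_n)$; here $\ell(Z,A)$ is the completed direct sum over $z\in Z$ of copies of $A$ with norm rescaled by $\|z\|$ (the $\ell^1$-sum, resp. the $c_0$-sum if $\mathscr C=\mathrm{Ab}^{\mathrm{nA}}$), and $\ell(Z,A)\to Z$ sends the generator at $z$ to $z$. A bounded homomorphism $A_0\to A_1$ of Banach $R$-algebras in $\mathscr C$ is a *homotopy epimorphism* if the multiplication $A_1\widehat\otimes^{\mathbb L}_{A_0}A_1\to A_1$ is an isomorphism in $\mathrm{Der}^-_{\mathscr C}(A_0)$. **Theorem.** Let $X$ be a compact Hausdorff space and let $R$ be a Banach ring such that $(\mathscr C,X,R)$ is an admissible triple, i.e. one of the following holds: 1. $\mathscr C=\mathrm{Ab}^{\mathrm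 A}$, and $R$ is $\mathbb R$ or $\mathbb C$ with the usual absolute value; 2. $\mathscr C=\mathrm{Ab}^{\mathrm{nA}}$, $R$ is a finite field with the trivial norm or a non-Archimedean local field, and $X$ is totally disconnected. Then for every closed subset $K\subset X$ the restriction map $C(X,R)\to C(K,R)$, where both algebras carry the supremum norm, is a homotopy epimorphism of Banach $R$-algebras in $\mathscr C$. -/

import Mathlib

open CategoryTheory Limits TensorProduct
open scoped NNReal

universe u v

namespace BanachGeometry

/-! ## The two categories of Banach abelian groups -/

/-- The two ambient categories: `arch` is the category of Banach abelian groups and bounded group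
homomorphisms, `nonarch` its full subcategory of ultrametric Banach abelian groups. -/
inductive Ambient : Type
  | arch
  | nonarch

/-- The ultrametric inequality, imposed only in the case of the ambient category `nonarch`. -/
class Ultra (𝒞 : Ambient) (E : Type*) [Dist E] : Prop where
  isUltrametricDist : 𝒞 = .nonarch → IsUltrametricDist E

/-- The scalar multiplication `A × E → E` is bounded: `‖a • x‖ ≤ C ‖a‖ ‖x‖` for a constant `C`. -/
class BddSMul (A E : Type*) [Norm A] [Norm E] [SMul A E] : Prop where
  exists_bound : ∃ C : ℝ≥0, ∀ (a : A) (x : E), ‖a • x‖ ≤ C * ‖a‖ * ‖x‖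

/-- A map between normed sets is bounded if `‖f x‖ ≤ C ‖x‖` for a constant `C`. -/
def IsBdd {E F : Type*} [Norm E] [Norm F] (f : E → F) : Prop :=
  ∃ C : ℝ≥0, ∀ x, ‖f x‖ ≤ C * ‖x‖

/-- The size of a finite family of nonnegative reals: its sum in the Archimedean case, its maximum
(`0` for the empty family) in the non-Archimedean case. -/
noncomputable def agg (𝒞 : Ambient) {ι : Type*} (s : Finset ι) (w : ι → ℝ≥0) : ℝ≥0 :=
  match 𝒞 with
  | .arch => ∑ i ∈ s, w i
  | .nonarch => s.sup w

/-- The size of a pair of nonnegative reals (sum, resp. maximum). -/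
noncomputable def comb (𝒞 : Ambient) (a b : ℝ≥0) : ℝ≥0 :=
  match 𝒞 with
  | .arch => a + b
  | .nonarch => max a b

section Aux

variable {𝒞 : Ambient} {ι : Type*}

theorem comb_le_add (a b : ℝ≥0) : comb 𝒞 a b ≤ a + b := by
  cases 𝒞 <;> simp [comb]

theorem comb_mono {a b c d : ℝ≥0} (h : a ≤ c) (h' : b ≤ d) : comb 𝒞 a b ≤ comb 𝒞 c d := by
  cases 𝒞
  · exact add_le_add h h'
  · exact max_le_max h h'

theorem comb_add_le (a b e : ℝ≥0) : comb 𝒞 (a + e) (b + e) ≤ comb 𝒞 a b + (e + e) := by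
  cases 𝒞
  · simp only [comb]
    exact le_of_eq (by ring)
  · simp only [comb]
    refine max_le ?_ ?_
    · exact add_le_add (le_max_left _ _) (le_add_of_nonneg_left (zero_le (a := e)))
    · exact add_le_add (le_max_right _ _) (le_add_of_nonneg_left (zero_le (a := e)))

theorem agg_le_mul (s : Finset ι) (w v : ι → ℝ≥0) (c : ℝ≥0) (h : ∀ i ∈ s, w i ≤ c * v i) :
    agg 𝒞 s w ≤ c * agg 𝒞 s v := by
  cases 𝒞
  · simp only [agg, Finset.mul_sum]
    exact Finset.sum_le_sum h
  · simp only [agg]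
    exact Finset.sup_le fun i hi => (h i hi).trans (mul_le_mul_right (Finset.le_sup hi) c)

theorem agg_comb_le (s : Finset ι) (w v z : ι → ℝ≥0) (h : ∀ i ∈ s, w i ≤ comb 𝒞 (v i) (z i)) :
    agg 𝒞 s w ≤ comb 𝒞 (agg 𝒞 s v) (agg 𝒞 s z) := by
  cases 𝒞
  · simp only [agg, comb, ← Finset.sum_add_distrib] at h ⊢
    exact Finset.sum_le_sum h
  · simp only [agg, comb] at h ⊢
    exact Finset.sup_le fun i hi =>
      (h i hi).trans (max_le_max (Finset.le_sup hi) (Finset.le_sup hi))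

theorem agg_subset {s t : Finset ι} (hst : s ⊆ t) (w : ι → ℝ≥0) (h : ∀ i ∈ t, i ∉ s → w i = 0) :
    agg 𝒞 t w = agg 𝒞 s w := by
  cases 𝒞
  · exact (Finset.sum_subset hst h).symm
  · simp only [agg]
    refine le_antisymm (Finset.sup_le fun i hi => ?_) (Finset.sup_mono hst)
    by_cases his : i ∈ s
    · exact Finset.le_sup his
    · rw [h i hi his]
      exact zero_le

theorem agg_append {m n : ℕ} (w : Fin (m + n) → ℝ≥0) :
    agg 𝒞 Finset.univ w ≤ comb 𝒞 (agg 𝒞 Finset.univ fun i => w (Fin.castAdd n i))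
      (agg 𝒞 Finset.univ fun i => w (Fin.natAdd m i)) := by
  cases 𝒞
  · simp only [agg, comb, Fin.sum_univ_add, le_refl]
  · simp only [agg, comb]
    refine Finset.sup_le fun i _ => ?_
    induction i using Fin.addCases with
    | left i =>
      exact le_max_of_le_left
        (Finset.le_sup (f := fun i => w (Fin.castAdd n i)) (Finset.mem_univ i))
    | right i =>
      exact le_max_of_le_right
        (Finset.le_sup (f := fun i => w (Fin.natAdd m i)) (Finset.mem_univ i))

theorem nnnorm_add_le_comb {E : Type*} [SeminormedAddCommGroup E] [h : Ultra 𝒞 E] (x y : E) :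
    ‖x + y‖₊ ≤ comb 𝒞 ‖x‖₊ ‖y‖₊ := by
  cases 𝒞
  · exact nnnorm_add_le x y
  · have := h.isUltrametricDist rfl
    exact IsUltrametricDist.norm_add_le_max x y

theorem nnnorm_sum_le_agg {E : Type*} [SeminormedAddCommGroup E] [h : Ultra 𝒞 E]
    (s : Finset ι) (x : ι → E) : ‖∑ i ∈ s, x i‖₊ ≤ agg 𝒞 s fun i => ‖x i‖₊ := by
  classical
  cases 𝒞
  · exact nnnorm_sum_le _ _
  · have := h.isUltrametricDist rfl
    simp only [agg]
    induction s using Finset.induction_on with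
    | empty => simp
    | insert a s ha ih =>
      rw [Finset.sum_insert ha, Finset.sup_insert]
      exact (IsUltrametricDist.norm_add_le_max _ _).trans (max_le_max le_rfl ih)

theorem ultra_of_comb {E : Type*} [SeminormedAddCommGroup E]
    (h : ∀ x y : E, ‖x + y‖₊ ≤ comb 𝒞 ‖x‖₊ ‖y‖₊) : Ultra 𝒞 E where
  isUltrametricDist hC := by
    subst hC
    exact IsUltrametricDist.isUltrametricDist_of_forall_norm_add_le_max_norm fun x y => h x y

end Aux

/-! ## Banach modules -/

/-- A Banach `A`-module in the ambient category `𝒞`: an `A`-module with a complete norm, ultrametric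
if `𝒞 = nonarch`, for which the scalar multiplication is bounded (no submultiplicativity is
imposed). -/
structure BanMod (𝒞 : Ambient) (A : Type u) [NormedCommRing A] where
  carrier : Type u
  [normed : NormedAddCommGroup carrier]
  [module : Module A carrier]
  [bddSMul : BddSMul A carrier]
  [complete : CompleteSpace carrier]
  [ultra : Ultra 𝒞 carrier]

namespace BanMod

variable {𝒞 : Ambient} {A : Type u} [NormedCommRing A]

instance : CoeSort (BanMod 𝒞 A) (Type u) := ⟨carrier⟩

attribute [instance] normed module bddSMul complete ultra

end BanMod

/-- The group of bounded `A`-linear maps. -/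
def bddHom (A E F : Type*) [NormedCommRing A] [SeminormedAddCommGroup E] [Module A E]
    [SeminormedAddCommGroup F] [Module A F] : AddSubgroup (E →ₗ[A] F) where
  carrier := {f | IsBdd f}
  zero_mem' := ⟨0, by simp⟩
  add_mem' := by
    rintro f g ⟨C, hC⟩ ⟨D, hD⟩
    refine ⟨C + D, fun x => (norm_add_le _ _).trans ?_⟩
    rw [NNReal.coe_add, add_mul]
    exact add_le_add (hC x) (hD x)
  neg_mem' := by
    rintro f ⟨C, hC⟩
    exact ⟨C, fun x => by simpa using hC x⟩

namespace BanMod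

variable {𝒞 : Ambient} {A : Type u} [NormedCommRing A]

/-- The category of Banach `A`-modules and bounded `A`-linear maps. -/
instance : Category (BanMod 𝒞 A) where
  Hom M N := bddHom A M N
  id M := ⟨LinearMap.id, 1, by simp⟩
  comp f g := ⟨g.1 ∘ₗ f.1, by
    obtain ⟨C, hC⟩ := f.2
    obtain ⟨D, hD⟩ := g.2
    refine ⟨D * C, fun x => (hD _).trans ?_⟩
    rw [NNReal.coe_mul, mul_assoc]
    exact mul_le_mul_of_nonneg_left (hC x) D.2⟩

/-- The linear map underlying a morphism of Banach modules. -/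
def Hom.lin {M N : BanMod 𝒞 A} (f : M ⟶ N) : M →ₗ[A] N := f.1

/-- The morphism of Banach modules given by a bounded linear map. -/
def ofLin {M N : BanMod 𝒞 A} (f : M →ₗ[A] N) (hf : IsBdd f) : M ⟶ N := ⟨f, hf⟩

theorem Hom.isBdd {M N : BanMod 𝒞 A} (f : M ⟶ N) : IsBdd (Hom.lin f) := f.2

@[simp] theorem lin_ofLin {M N : BanMod 𝒞 A} (f : M →ₗ[A] N) (hf : IsBdd f) :
    Hom.lin (ofLin f hf) = f := rfl

theorem hom_ext {M N : BanMod 𝒞 A} {f g : M ⟶ N} (h : ∀ x, Hom.lin f x = Hom.lin g x) : f = g :=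
  Subtype.ext (LinearMap.ext h)

@[simp] theorem lin_id (M : BanMod 𝒞 A) (x : M) : Hom.lin (𝟙 M) x = x := rfl

@[simp] theorem lin_comp {M N P : BanMod 𝒞 A} (f : M ⟶ N) (g : N ⟶ P) (x : M) :
    Hom.lin (f ≫ g) x = Hom.lin g (Hom.lin f x) := rfl

instance : Preadditive (BanMod 𝒞 A) where
  homGroup M N := inferInstanceAs (AddCommGroup (bddHom A M N))
  add_comp _ _ _ f f' g := hom_ext fun x => map_add (Hom.lin g) (Hom.lin f x) (Hom.lin f' x)
  comp_add _ _ _ _ _ _ := hom_ext fun _ => rfl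

@[simp] theorem lin_add {M N : BanMod 𝒞 A} (f g : M ⟶ N) (x : M) :
    Hom.lin (f + g) x = Hom.lin f x + Hom.lin g x := rfl

@[simp] theorem lin_zero {M N : BanMod 𝒞 A} (x : M) : Hom.lin (0 : M ⟶ N) x = 0 := rfl

/-- The zero Banach module. -/
def zero : BanMod 𝒞 A where
  carrier := PUnit
  bddSMul := ⟨0, by simp⟩
  ultra := ⟨fun _ => ⟨fun _ _ _ => by simp⟩⟩

instance : HasZeroObject (BanMod 𝒞 A) where
  zero := ⟨zero, (IsZero.iff_id_eq_zero _).2 (hom_ext fun _ => rfl)⟩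

/-- The direct sum of two Banach modules, with the maximum norm. -/
def prod (M N : BanMod 𝒞 A) : BanMod 𝒞 A where
  carrier := M × N
  bddSMul := by
    obtain ⟨C, hC⟩ := M.bddSMul.exists_bound
    obtain ⟨D, hD⟩ := N.bddSMul.exists_bound
    refine ⟨max C D, fun a x => max_le ((hC a x.1).trans ?_) ((hD a x.2).trans ?_)⟩
    · gcongr
      · exact NNReal.coe_le_coe.2 (le_max_left C D)
      · exact norm_fst_le x
    · gcongr
      · exact NNReal.coe_le_coe.2 (le_max_right C D)
      · exact norm_snd_le x
  ultra := ultra_of_comb fun x y => by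
    have h1 := nnnorm_add_le_comb (𝒞 := 𝒞) x.1 y.1
    have h2 := nnnorm_add_le_comb (𝒞 := 𝒞) x.2 y.2
    exact max_le (h1.trans (comb_mono (le_max_left _ _) (le_max_left _ _)))
      (h2.trans (comb_mono (le_max_right _ _) (le_max_right _ _)))

instance : HasBinaryBiproducts (BanMod 𝒞 A) where
  has_binary_biproduct M N := by
    let b : BinaryBicone M N :=
      { pt := prod M N
        fst := ofLin (LinearMap.fst A M N) ⟨1, fun x => (norm_fst_le (E := M) (F := N) x).trans_eq (one_mul _).symm⟩
        snd := ofLin (LinearMap.snd A M N) ⟨1, fun x => (norm_snd_le (E := M) (F := N) x).trans_eq (one_mul _).symm⟩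
        inl := ofLin (LinearMap.inl A M N)
          ⟨1, fun x => (by simp : ‖((x, 0) : M × N)‖ = (1 : ℝ≥0) * ‖x‖).le⟩
        inr := ofLin (LinearMap.inr A M N)
          ⟨1, fun x => (by simp : ‖((0, x) : M × N)‖ = (1 : ℝ≥0) * ‖x‖).le⟩
        inl_fst := hom_ext fun x => rfl
        inl_snd := hom_ext fun x => rfl
        inr_fst := hom_ext fun x => rfl
        inr_snd := hom_ext fun x => rfl }
    refine hasBinaryBiproduct_of_total b (hom_ext fun x => ?_)
    exact Prod.fst_add_snd (M := M) (N := N) x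

instance : HasFiniteProducts (BanMod 𝒞 A) := hasFiniteProducts_of_has_binary_and_terminal

instance : HasFiniteBiproducts (BanMod 𝒞 A) := HasFiniteBiproducts.of_hasFiniteProducts

/-- The kernel of a morphism of Banach modules, with the restricted norm. -/
def ker {M N : BanMod 𝒞 A} (f : M ⟶ N) : BanMod 𝒞 A where
  carrier := LinearMap.ker (Hom.lin f)
  bddSMul := by
    obtain ⟨C, hC⟩ := M.bddSMul.exists_bound
    exact ⟨C, fun a x => hC a x.1⟩
  complete := by
    obtain ⟨C, hC⟩ := Hom.isBdd f
    have hf : Continuous (Hom.lin f) :=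
      AddMonoidHomClass.continuous_of_bound (Hom.lin f) C hC
    have : IsClosed ((LinearMap.ker (Hom.lin f) : Submodule A M) : Set M) :=
      isClosed_singleton.preimage hf
    exact this.completeSpace_coe
  ultra := ultra_of_comb fun x y => nnnorm_add_le_comb (𝒞 := 𝒞) x.1 y.1

/-- The inclusion of the kernel. -/
def kerι {M N : BanMod 𝒞 A} (f : M ⟶ N) : ker f ⟶ M :=
  ofLin (LinearMap.ker (Hom.lin f)).subtype ⟨1, fun x => (one_mul ‖x.1‖).symm.le⟩

theorem kerι_comp {M N : BanMod 𝒞 A} (f : M ⟶ N) : kerι f ≫ f = 0 := hom_ext fun x => x.2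

/-! ### Strictness -/

/-- A morphism is strict if `coim f = M / ker f → im f` is an isomorphism. The categorical image of
`f` is the closure of the set-theoretic image, so this says that the set-theoretic image is closed
and that its quotient norm is equivalent to the norm induced from the target. -/
def IsStrict {M N : BanMod 𝒞 A} (f : M ⟶ N) : Prop :=
  IsClosed (Set.range (Hom.lin f)) ∧
    ∃ C : ℝ≥0, ∀ x, ∃ x', Hom.lin f x' = Hom.lin f x ∧ ‖x'‖ ≤ C * ‖Hom.lin f x‖

/-- The sequence `M → N → P` is strictly exact at `N` if `f` is strict and `im f = ker g`, where
`im f` is the categorical image, i.e. the closure of the set-theoretic image. -/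
def StrictlyExactAt {M N P : BanMod 𝒞 A} (f : M ⟶ N) (g : N ⟶ P) : Prop :=
  IsStrict f ∧ closure (Set.range (Hom.lin f)) = {y | Hom.lin g y = 0}

end BanMod

/-! ## Completions -/

section Completion

variable {𝒞 : Ambient} {A : Type u} [NormedCommRing A]

instance {E : Type*} [SeminormedAddCommGroup E] [Module A E] [h : BddSMul A E] :
    UniformContinuousConstSMul A E where
  uniformContinuous_const_smul a := by
    obtain ⟨C, hC⟩ := h.exists_bound
    exact uniformContinuous_of_continuousAt_zero (DistribSMul.toAddMonoidHom E a)
      (AddMonoidHomClass.continuous_of_bound (DistribSMul.toAddMonoidHom E a) (C * ‖a‖)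
        (hC a)).continuousAt

theorem completion_norm_smul_le {E : Type*} [SeminormedAddCommGroup E] [Module A E] [BddSMul A E]
    (C : ℝ≥0) (hC : ∀ (a : A) (x : E), ‖a • x‖ ≤ C * ‖a‖ * ‖x‖) (a : A)
    (x : UniformSpace.Completion E) : ‖a • x‖ ≤ C * ‖a‖ * ‖x‖ := by
  induction x using UniformSpace.Completion.induction_on with
  | hp =>
    exact isClosed_le (continuous_norm.comp (continuous_const_smul a))
      (continuous_const.mul continuous_norm)
  | ih x =>
    rw [← UniformSpace.Completion.coe_smul, UniformSpace.Completion.norm_coe,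
      UniformSpace.Completion.norm_coe]
    exact hC a x

theorem completion_ultrametric {E : Type*} [SeminormedAddCommGroup E] [IsUltrametricDist E] :
    IsUltrametricDist (UniformSpace.Completion E) := by
  refine IsUltrametricDist.isUltrametricDist_of_forall_norm_add_le_max_norm fun x y => ?_
  induction x, y using UniformSpace.Completion.induction_on₂ with
  | hp =>
    exact isClosed_le (continuous_norm.comp continuous_add)
      ((continuous_norm.comp continuous_fst).max (continuous_norm.comp continuous_snd))
  | ih x y =>
    rw [← UniformSpace.Completion.coe_add]
    simp only [UniformSpace.Completion.norm_coe]
    exact IsUltrametricDist.norm_add_le_max x y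

/-- The separated completion of a seminormed module with bounded scalar multiplication. -/
noncomputable def completeObj (𝒞 : Ambient) (A E : Type u) [NormedCommRing A]
    [SeminormedAddCommGroup E] [Module A E] [h : BddSMul A E] [h' : Ultra 𝒞 E] : BanMod 𝒞 A where
  carrier := UniformSpace.Completion E
  bddSMul := ⟨h.exists_bound.choose, completion_norm_smul_le _ h.exists_bound.choose_spec⟩
  ultra := ⟨fun hC => by
    have := h'.isUltrametricDist hC
    exact completion_ultrametric⟩

variable {E : Type u} [SeminormedAddCommGroup E] [Module A E] [BddSMul A E] [Ultra 𝒞 E]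

/-- The canonical map to the completion. -/
def toComplete (x : E) : completeObj 𝒞 A E := (x : UniformSpace.Completion E)

theorem extension_smul {E F : Type*} [SeminormedAddCommGroup E] [Module A E] [BddSMul A E]
    [NormedAddCommGroup F] [Module A F] [BddSMul A F] [CompleteSpace F] (g : NormedAddGroupHom E F)
    (hg : ∀ (a : A) (x : E), g (a • x) = a • g x) (a : A) (x : UniformSpace.Completion E) :
    g.extension (a • x) = a • g.extension x := by
  induction x using UniformSpace.Completion.induction_on with
  | hp =>
    exact isClosed_eq (g.extension.continuous.comp (continuous_const_smul a))
      (g.extension.continuous.const_smul a)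
  | ih x =>
    rw [← UniformSpace.Completion.coe_smul, NormedAddGroupHom.extension_coe,
      NormedAddGroupHom.extension_coe]
    exact hg a x

/-- The extension by continuity of a bounded linear map to the completion. -/
noncomputable def completeLift {N : BanMod 𝒞 A} (f : E →ₗ[A] N) (hf : IsBdd f) :
    completeObj 𝒞 A E ⟶ N :=
  let g : NormedAddGroupHom E N :=
    { toFun := f
      map_add' := map_add f
      bound' := ⟨hf.choose, hf.choose_spec⟩ }
  BanMod.ofLin (M := completeObj 𝒞 A E)
    { toFun := g.extension
      map_add' := map_add g.extension
      map_smul' := extension_smul g (map_smul f) }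
    ⟨‖g.extension‖₊, g.extension.le_opNorm⟩

theorem completeLift_coe {N : BanMod 𝒞 A} (f : E →ₗ[A] N) (hf : IsBdd f) (x : E) :
    BanMod.Hom.lin (completeLift f hf) (toComplete x) = f x :=
  NormedAddGroupHom.extension_coe _ x

theorem continuous_lin {M N : BanMod 𝒞 A} (f : M ⟶ N) : Continuous (BanMod.Hom.lin f) := by
  obtain ⟨C, hC⟩ := BanMod.Hom.isBdd f
  exact AddMonoidHomClass.continuous_of_bound (BanMod.Hom.lin f) C hC

theorem complete_hom_ext {N : BanMod 𝒞 A} {f g : completeObj 𝒞 A E ⟶ N}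
    (h : ∀ x : E, BanMod.Hom.lin f (toComplete x) = BanMod.Hom.lin g (toComplete x)) : f = g :=
  BanMod.hom_ext fun x =>
    UniformSpace.Completion.induction_on (α := E)
      (p := fun x => BanMod.Hom.lin f x = BanMod.Hom.lin g x) x
      (isClosed_eq (continuous_lin f) (continuous_lin g)) h

/-- The canonical map to the completion, as a linear map. -/
def toCompleteLin (𝒞 : Ambient) (A E : Type u) [NormedCommRing A]
    [SeminormedAddCommGroup E] [Module A E] [BddSMul A E] [Ultra 𝒞 E] :
    E →ₗ[A] completeObj 𝒞 A E where
  toFun := toComplete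
  map_add' x y := UniformSpace.Completion.coe_add x y
  map_smul' a x := UniformSpace.Completion.coe_smul a x

theorem norm_toComplete (x : E) : ‖(toComplete x : completeObj 𝒞 A E)‖ = ‖x‖ :=
  UniformSpace.Completion.norm_coe x

end Completion

/-! ## The completed tensor product -/

/-- The algebraic tensor product over `A`, to be equipped with the tensor seminorm. -/
def PreTensor (_𝒞 : Ambient) (A M N : Type u) [NormedCommRing A]
    [NormedAddCommGroup M] [Module A M] [NormedAddCommGroup N] [Module A N] : Type u :=
  M ⊗[A] N

namespace PreTensor

variable {𝒞 : Ambient} {A M N : Type u} [NormedCommRing A]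
  [NormedAddCommGroup M] [Module A M] [NormedAddCommGroup N] [Module A N]

instance : AddCommGroup (PreTensor 𝒞 A M N) := inferInstanceAs (AddCommGroup (M ⊗[A] N))

instance : Module A (PreTensor 𝒞 A M N) := inferInstanceAs (Module A (M ⊗[A] N))

/-- The possible sizes `∑ ‖mᵢ‖ ‖kᵢ‖` (resp. `max ‖mᵢ‖ ‖kᵢ‖`) of expressions `t = ∑ mᵢ ⊗ kᵢ`. -/
def sizes (t : PreTensor 𝒞 A M N) : Set ℝ≥0 :=
  {r | ∃ (n : ℕ) (m : Fin n → M) (k : Fin n → N),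
    ∑ i, (m i ⊗ₜ[A] k i : M ⊗[A] N) = t ∧ agg 𝒞 Finset.univ (fun i => ‖m i‖₊ * ‖k i‖₊) = r}

/-- The tensor seminorm. -/
noncomputable def seminorm (t : PreTensor 𝒞 A M N) : ℝ≥0 := sInf (sizes t)

theorem sizes_nonempty (t : PreTensor 𝒞 A M N) : (sizes t).Nonempty := by
  suffices h : ∃ (n : ℕ) (m : Fin n → M) (k : Fin n → N),
      ∑ i, (m i ⊗ₜ[A] k i : M ⊗[A] N) = t by
    obtain ⟨n, m, k, h⟩ := h
    exact ⟨_, n, m, k, h, rfl⟩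
  induction t using TensorProduct.induction_on with
  | zero => exact ⟨0, 0, 0, rfl⟩
  | tmul x y => exact ⟨1, fun _ => x, fun _ => y, by simp⟩
  | add s t hs ht =>
    obtain ⟨n, m, k, h⟩ := hs
    obtain ⟨n', m', k', h'⟩ := ht
    refine ⟨n + n', Fin.append m m', Fin.append k k', ?_⟩
    rw [Fin.sum_univ_add]
    simp only [Fin.append_left, Fin.append_right]
    rw [h, h']

theorem seminorm_le {t : PreTensor 𝒞 A M N} {r : ℝ≥0} (h : r ∈ sizes t) : seminorm t ≤ r :=
  csInf_le (OrderBot.bddBelow _) h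

theorem exists_size_lt (t : PreTensor 𝒞 A M N) {e : ℝ≥0} (he : 0 < e) :
    ∃ r ∈ sizes t, r < seminorm t + e :=
  exists_lt_of_csInf_lt (sizes_nonempty t) (lt_add_of_pos_right _ he)

theorem seminorm_tmul_le (x : M) (y : N) :
    seminorm (𝒞 := 𝒞) (x ⊗ₜ[A] y : M ⊗[A] N) ≤ ‖x‖₊ * ‖y‖₊ :=
  seminorm_le ⟨1, fun _ => x, fun _ => y, by simp, by cases 𝒞 <;> simp [agg]⟩

theorem seminorm_add_le (s t : PreTensor 𝒞 A M N) :
    seminorm (s + t) ≤ comb 𝒞 (seminorm s) (seminorm t) := by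
  refine le_of_forall_pos_le_add fun e he => ?_
  obtain ⟨r, ⟨n, m, k, h, hr⟩, hlt⟩ := exists_size_lt s (half_pos he)
  obtain ⟨r', ⟨n', m', k', h', hr'⟩, hlt'⟩ := exists_size_lt t (half_pos he)
  have h1 : seminorm (s + t) ≤ agg 𝒞 Finset.univ
      (fun i => ‖Fin.append m m' i‖₊ * ‖Fin.append k k' i‖₊) := by
    refine seminorm_le ⟨n + n', Fin.append m m', Fin.append k k', ?_, rfl⟩
    rw [Fin.sum_univ_add]
    simp only [Fin.append_left, Fin.append_right]
    rw [h, h']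
    rfl
  have h2 := agg_append (𝒞 := 𝒞) (fun i => ‖Fin.append m m' i‖₊ * ‖Fin.append k k' i‖₊)
  simp only [Fin.append_left, Fin.append_right, hr, hr'] at h2
  refine h1.trans (h2.trans ((comb_mono hlt.le hlt'.le).trans ((comb_add_le _ _ _).trans ?_)))
  rw [add_halves]

/-- A bilinear map bounded by `C` induces a linear map of norm at most `C` on the tensor product. -/
theorem nnnorm_lift_le {F : Type*} [SeminormedAddCommGroup F] [Module A F] [Ultra 𝒞 F]
    (B : M →ₗ[A] N →ₗ[A] F) (C : ℝ≥0) (hB : ∀ x y, ‖B x y‖₊ ≤ C * (‖x‖₊ * ‖y‖₊))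
    (t : PreTensor 𝒞 A M N) : ‖TensorProduct.lift B t‖₊ ≤ C * seminorm t := by
  refine le_of_forall_pos_le_add fun e he => ?_
  have hd : 0 < e / (C + 1) := div_pos he (by positivity)
  obtain ⟨r, ⟨n, m, k, h, hr⟩, hlt⟩ := exists_size_lt t hd
  have h1 : TensorProduct.lift B t = ∑ i, B (m i) (k i) := by
    rw [← h, map_sum]
    simp
  rw [h1]
  calc _ ≤ agg 𝒞 Finset.univ fun i => ‖B (m i) (k i)‖₊ := nnnorm_sum_le_agg _ _
    _ ≤ C * r := hr ▸ agg_le_mul _ _ _ _ fun i _ => hB _ _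
    _ ≤ C * (seminorm t + e / (C + 1)) := by gcongr
    _ = C * seminorm t + C * (e / (C + 1)) := mul_add _ _ _
    _ ≤ C * seminorm t + (C + 1) * (e / (C + 1)) := by gcongr; simp
    _ = C * seminorm t + e := by rw [mul_div_cancel₀]; positivity

theorem seminorm_neg_le (t : PreTensor 𝒞 A M N) : seminorm (-t) ≤ seminorm t := by
  refine le_csInf (sizes_nonempty t) ?_
  rintro r ⟨n, m, k, h, rfl⟩
  refine seminorm_le ⟨n, fun i => -m i, k, ?_, by simp⟩
  simp only [TensorProduct.neg_tmul, Finset.sum_neg_distrib]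
  rw [h]
  rfl

noncomputable instance : SeminormedAddCommGroup (PreTensor 𝒞 A M N) :=
  AddGroupSeminorm.toSeminormedAddCommGroup
    { toFun := fun t => seminorm t
      map_zero' := by
        have : seminorm (0 : PreTensor 𝒞 A M N) ≤ 0 :=
          seminorm_le ⟨0, 0, 0, rfl, by cases 𝒞 <;> simp [agg]⟩
        simpa using this
      add_le' := fun s t => by
        exact_mod_cast (seminorm_add_le s t).trans (comb_le_add _ _)
      neg' := fun t => by
        refine congrArg _ (le_antisymm (seminorm_neg_le t) ?_)
        simpa using seminorm_neg_le (-t) }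

theorem nnnorm_def (t : PreTensor 𝒞 A M N) : ‖t‖₊ = seminorm t := rfl

theorem norm_def (t : PreTensor 𝒞 A M N) : ‖t‖ = seminorm t := rfl

instance : Ultra 𝒞 (PreTensor 𝒞 A M N) := ultra_of_comb seminorm_add_le

instance [h : BddSMul A M] : BddSMul A (PreTensor 𝒞 A M N) where
  exists_bound := by
    obtain ⟨C, hC⟩ := h.exists_bound
    refine ⟨C, fun a t => ?_⟩
    suffices H : seminorm (a • t) ≤ C * ‖a‖₊ * seminorm t from H
    let B : M →ₗ[A] N →ₗ[A] PreTensor 𝒞 A M N := a • TensorProduct.mk A M N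
    have hB : TensorProduct.lift B t = a • t := by
      have : TensorProduct.lift B = a • (LinearMap.id : M ⊗[A] N →ₗ[A] M ⊗[A] N) :=
        TensorProduct.ext' fun x y => rfl
      rw [this]
      rfl
    rw [← hB]
    refine nnnorm_lift_le B _ (fun x y => ?_) t
    have h1 : B x y = ((a • x) ⊗ₜ[A] y : M ⊗[A] N) := rfl
    rw [h1, ← mul_assoc]
    have h2 : ‖a • x‖₊ ≤ C * ‖a‖₊ * ‖x‖₊ := hC a x
    exact (seminorm_tmul_le _ _).trans (mul_le_mul_left h2 _)

end PreTensor

namespace BanMod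

variable {𝒞 : Ambient} {A : Type u} [NormedCommRing A]

/-- The completed tensor product `M ⊗̂_A N`: the completion of `M ⊗_A N` for the tensor
seminorm. -/
noncomputable def tensor (M N : BanMod 𝒞 A) : BanMod 𝒞 A := completeObj 𝒞 A (PreTensor 𝒞 A M N)

/-- The morphism `M ⊗̂_A N → P` induced by a bounded bilinear map. -/
noncomputable def tensorLift {M N P : BanMod 𝒞 A} (B : M →ₗ[A] N →ₗ[A] P)
    (hB : ∃ C : ℝ≥0, ∀ x y, ‖B x y‖ ≤ C * (‖x‖ * ‖y‖)) : tensor M N ⟶ P :=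
  completeLift (E := PreTensor 𝒞 A M N) (TensorProduct.lift B) <| by
    obtain ⟨C, hC⟩ := hB
    exact ⟨C, fun t => PreTensor.nnnorm_lift_le B C hC t⟩

/-- The elementary tensor `x ⊗ y` in the completed tensor product. -/
noncomputable def tmul {M N : BanMod 𝒞 A} (x : M) (y : N) : tensor M N :=
  toComplete (E := PreTensor 𝒞 A M N) (x ⊗ₜ[A] y : M ⊗[A] N)

theorem norm_tmul_le {M N : BanMod 𝒞 A} (x : M) (y : N) : ‖tmul x y‖ ≤ ‖x‖ * ‖y‖ :=
  (norm_toComplete (E := PreTensor 𝒞 A M N) (x ⊗ₜ[A] y : M ⊗[A] N)).trans_le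
    (PreTensor.seminorm_tmul_le x y)

@[simp] theorem tensorLift_tmul {M N P : BanMod 𝒞 A} (B : M →ₗ[A] N →ₗ[A] P)
    (hB : ∃ C : ℝ≥0, ∀ x y, ‖B x y‖ ≤ C * (‖x‖ * ‖y‖)) (x : M) (y : N) :
    Hom.lin (tensorLift B hB) (tmul x y) = B x y :=
  (completeLift_coe (E := PreTensor 𝒞 A M N) _ _ _).trans (TensorProduct.lift.tmul x y)

theorem tensor_hom_ext {M N P : BanMod 𝒞 A} {f g : tensor M N ⟶ P}
    (h : ∀ x y, Hom.lin f (tmul x y) = Hom.lin g (tmul x y)) : f = g := by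
  refine complete_hom_ext (E := PreTensor 𝒞 A M N) fun t => ?_
  have : (Hom.lin f ∘ₗ toCompleteLin 𝒞 A (PreTensor 𝒞 A M N) : M ⊗[A] N →ₗ[A] P) =
      (Hom.lin g ∘ₗ toCompleteLin 𝒞 A (PreTensor 𝒞 A M N) : M ⊗[A] N →ₗ[A] P) :=
    TensorProduct.ext' h
  exact LinearMap.congr_fun this t

/-- The morphism `f ⊗̂ g`. -/
noncomputable def tensorMap {M M' N N' : BanMod 𝒞 A} (f : M ⟶ M') (g : N ⟶ N') :
    tensor M N ⟶ tensor M' N' :=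
  tensorLift
    (((TensorProduct.mk A M' N').compl₁₂ (Hom.lin f) (Hom.lin g)).compr₂
      (toCompleteLin 𝒞 A (PreTensor 𝒞 A M' N') : M' ⊗[A] N' →ₗ[A] tensor M' N')) <| by
    obtain ⟨C, hC⟩ := Hom.isBdd f
    obtain ⟨D, hD⟩ := Hom.isBdd g
    refine ⟨C * D, fun x y => (norm_tmul_le (Hom.lin f x) (Hom.lin g y)).trans ?_⟩
    rw [NNReal.coe_mul, mul_mul_mul_comm]
    exact mul_le_mul (hC x) (hD y) (norm_nonneg _) (mul_nonneg C.2 (norm_nonneg _))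

@[simp] theorem tensorMap_tmul {M M' N N' : BanMod 𝒞 A} (f : M ⟶ M') (g : N ⟶ N') (x : M) (y : N) :
    Hom.lin (tensorMap f g) (tmul x y) = tmul (Hom.lin f x) (Hom.lin g y) :=
  tensorLift_tmul _ _ x y

theorem tmul_add {M N : BanMod 𝒞 A} (x : M) (y y' : N) : tmul x (y + y') = tmul x y + tmul x y' :=
  (congrArg (toCompleteLin 𝒞 A (PreTensor 𝒞 A M N)) (TensorProduct.tmul_add x y y')).trans
    (map_add (toCompleteLin 𝒞 A (PreTensor 𝒞 A M N)) _ _)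

theorem add_tmul {M N : BanMod 𝒞 A} (x x' : M) (y : N) : tmul (x + x') y = tmul x y + tmul x' y :=
  (congrArg (toCompleteLin 𝒞 A (PreTensor 𝒞 A M N)) (TensorProduct.add_tmul x x' y)).trans
    (map_add (toCompleteLin 𝒞 A (PreTensor 𝒞 A M N)) _ _)

/-- The completed tensor product as a bifunctor. -/
noncomputable def tensorFunctor (𝒞 : Ambient) (A : Type u) [NormedCommRing A] :
    BanMod 𝒞 A ⥤ BanMod 𝒞 A ⥤ BanMod 𝒞 A where
  obj M :=
    { obj := fun N => tensor M N
      map := fun g => tensorMap (𝟙 M) g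
      map_id := fun N => tensor_hom_ext fun x y => by simp
      map_comp := fun f g => tensor_hom_ext fun x y => by simp }
  map f :=
    { app := fun N => tensorMap f (𝟙 N)
      naturality := fun N N' g => tensor_hom_ext fun x y => by simp }
  map_id M := by
    ext N
    exact tensor_hom_ext fun x y => by simp
  map_comp f g := by
    ext N
    exact tensor_hom_ext fun x y => by simp

theorem add_tensorMap {M M' N N' : BanMod 𝒞 A} (f f' : M ⟶ M') (g : N ⟶ N') :
    tensorMap (f + f') g = tensorMap f g + tensorMap f' g :=
  tensor_hom_ext fun x y => by
    rw [lin_add, tensorMap_tmul, tensorMap_tmul, tensorMap_tmul, lin_add, add_tmul]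

theorem tensorMap_add {M M' N N' : BanMod 𝒞 A} (f : M ⟶ M') (g g' : N ⟶ N') :
    tensorMap f (g + g') = tensorMap f g + tensorMap f g' :=
  tensor_hom_ext fun x y => by
    rw [lin_add, tensorMap_tmul, tensorMap_tmul, tensorMap_tmul, lin_add, tmul_add]

instance : (tensorFunctor 𝒞 A).Additive where
  map_add {_ _ f g} := by
    ext N
    exact add_tensorMap f g (𝟙 N)

instance (M : BanMod 𝒞 A) : ((tensorFunctor 𝒞 A).obj M).Additive where
  map_add {_ _ f g} := tensorMap_add (𝟙 M) f g

end BanMod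

/-! ## Free modules on normed sets and the functorial resolution -/

/-- The algebraic direct sum `⨁_{x ∈ M} A_{‖x‖}`, where `A_r` is the regular module with its norm
rescaled by `r`. -/
def PreFree (_𝒞 : Ambient) (A M : Type u) [NormedCommRing A] [NormedAddCommGroup M] : Type u :=
  M →₀ A

namespace PreFree

variable {𝒞 : Ambient} {A M : Type u} [NormedCommRing A] [NormedAddCommGroup M]

noncomputable instance : AddCommGroup (PreFree 𝒞 A M) := inferInstanceAs (AddCommGroup (M →₀ A))

noncomputable instance : Module A (PreFree 𝒞 A M) := inferInstanceAs (Module A (M →₀ A))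

/-- The underlying finitely supported function. -/
def toFinsupp (f : PreFree 𝒞 A M) : M →₀ A := f

/-- The `ℓ¹`-seminorm (resp. `ℓ^∞`-seminorm) with weights `‖x‖`. -/
noncomputable def seminorm (f : PreFree 𝒞 A M) : ℝ≥0 :=
  agg 𝒞 (toFinsupp f).support fun x => ‖toFinsupp f x‖₊ * ‖x‖₊

theorem seminorm_eq {f : PreFree 𝒞 A M} {s : Finset M} (hs : (toFinsupp f).support ⊆ s) :
    seminorm f = agg 𝒞 s fun x => ‖toFinsupp f x‖₊ * ‖x‖₊ :=
  (agg_subset hs _ fun x _ hx => by simp [Finsupp.notMem_support_iff.1 hx]).symm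

theorem seminorm_add_le [Ultra 𝒞 A] (f g : PreFree 𝒞 A M) :
    seminorm (f + g) ≤ comb 𝒞 (seminorm f) (seminorm g) := by
  classical
  rw [seminorm_eq (f := f + g) (s := (toFinsupp f).support ∪ (toFinsupp g).support)
      Finsupp.support_add,
    seminorm_eq (f := f) (s := (toFinsupp f).support ∪ (toFinsupp g).support)
      Finset.subset_union_left,
    seminorm_eq (f := g) (s := (toFinsupp f).support ∪ (toFinsupp g).support)
      Finset.subset_union_right]
  refine agg_comb_le _ _ _ _ fun x _ => ?_
  have h1 : toFinsupp (f + g) x = toFinsupp f x + toFinsupp g x := rfl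
  have h2 := nnnorm_add_le_comb (𝒞 := 𝒞) (toFinsupp f x) (toFinsupp g x)
  rw [h1]
  refine (mul_le_mul_left h2 _).trans ?_
  cases 𝒞
  · simp only [comb]
    rw [add_mul]
  · simp only [comb]
    rw [max_mul]

noncomputable instance [Ultra 𝒞 A] : SeminormedAddCommGroup (PreFree 𝒞 A M) :=
  AddGroupSeminorm.toSeminormedAddCommGroup
    { toFun := fun t => seminorm t
      map_zero' := by
        have : (toFinsupp (0 : PreFree 𝒞 A M)).support = ∅ := Finsupp.support_zero
        rw [seminorm, this]
        cases 𝒞 <;> simp [agg]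
      add_le' := fun s t => by
        exact_mod_cast (seminorm_add_le s t).trans (comb_le_add _ _)
      neg' := fun t => by
        have h : (toFinsupp (-t)).support = (toFinsupp t).support := Finsupp.support_neg _
        have h' : ∀ x, toFinsupp (-t) x = -toFinsupp t x := fun x => rfl
        simp only [seminorm, h, h', nnnorm_neg] }

instance [Ultra 𝒞 A] : Ultra 𝒞 (PreFree 𝒞 A M) := ultra_of_comb seminorm_add_le

instance [Ultra 𝒞 A] : BddSMul A (PreFree 𝒞 A M) where
  exists_bound := by
    refine ⟨1, fun a f => ?_⟩
    rw [NNReal.coe_one, one_mul]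
    suffices H : seminorm (a • f) ≤ ‖a‖₊ * seminorm f from H
    rw [seminorm_eq (f := a • f) (s := (toFinsupp f).support) Finsupp.support_smul]
    refine agg_le_mul _ _ _ _ fun x _ => ?_
    rw [← mul_assoc]
    exact mul_le_mul_left (nnnorm_mul_le a (toFinsupp f x)) _

end PreFree

namespace BanMod

variable {𝒞 : Ambient} {A : Type u} [NormedCommRing A] [Ultra 𝒞 A]

/-- The Banach module `ℓ(M, A)`: the completed direct sum of the `A_{‖x‖}`, `x ∈ M`. -/
noncomputable def free (M : BanMod 𝒞 A) : BanMod 𝒞 A := completeObj 𝒞 A (PreFree 𝒞 A M)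

/-- The counit `ℓ(M, A) → M`, sending the generator at `x` to `x`. -/
noncomputable def counit (M : BanMod 𝒞 A) : free M ⟶ M :=
  completeLift (E := PreFree 𝒞 A M) (Finsupp.linearCombination A (id : M → M)) <| by
    obtain ⟨C, hC⟩ := M.bddSMul.exists_bound
    refine ⟨C, fun f => ?_⟩
    have h : ‖Finsupp.linearCombination A (id : M → M) f‖₊ ≤ C * PreFree.seminorm f := by
      refine (nnnorm_sum_le_agg (𝒞 := 𝒞) _ _).trans (agg_le_mul _ _ _ _ fun x _ => ?_)
      rw [← mul_assoc]
      exact hC _ x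
    exact h

/-- The iterated kernels of the counits: `Z₀ = M` and `Zₙ₊₁ = ker (ℓ(Zₙ, A) → Zₙ)`. -/
noncomputable def syzygy (M : BanMod 𝒞 A) : ℕ → BanMod 𝒞 A
  | 0 => M
  | n + 1 => ker (counit (syzygy M n))

/-- The inclusion `Zₙ₊₁ → ℓ(Zₙ, A)`. -/
noncomputable def syzygyι (M : BanMod 𝒞 A) (n : ℕ) : syzygy M (n + 1) ⟶ free (syzygy M n) :=
  kerι (counit (syzygy M n))

theorem syzygyι_counit (M : BanMod 𝒞 A) (n : ℕ) : syzygyι M n ≫ counit (syzygy M n) = 0 :=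
  kerι_comp _

/-- The functorial projective resolution
`⋯ → ℓ(Z₂, A) → ℓ(Z₁, A) → ℓ(Z₀, A)` of `M = Z₀`. -/
noncomputable def resolution (M : BanMod 𝒞 A) : ChainComplex (BanMod 𝒞 A) ℕ :=
  ChainComplex.of (fun n => free (syzygy M n))
    (fun n => counit (syzygy M (n + 1)) ≫ syzygyι M n)
    (fun n => by
      rw [Category.assoc, ← Category.assoc (syzygyι M (n + 1)), syzygyι_counit, zero_comp,
        comp_zero])

/-- The augmentation of the resolution in degree `0`. -/
noncomputable def augmentation (M : BanMod 𝒞 A) : (resolution M).X 0 ⟶ M := counit M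

theorem resolution_d_augmentation (M : BanMod 𝒞 A) :
    (resolution M).d 1 0 ≫ augmentation M = 0 := by
  have h : (resolution M).d 1 0 = counit (syzygy M 1) ≫ syzygyι M 0 :=
    ChainComplex.of_d (fun n => free (syzygy M n))
      (fun n => counit (syzygy M (n + 1)) ≫ syzygyι M n) 0
  rw [h]
  exact (Category.assoc _ _ _).trans
    ((congrArg (counit (syzygy M 1) ≫ ·) (syzygyι_counit M 0)).trans comp_zero)

end BanMod

/-! ## The derived category -/

section Derived

variable {𝒞 : Ambient} {A : Type u} [NormedCommRing A]

/-- A complex of Banach modules is strictly exact if it is so in every degree. -/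
def StrictlyExact (K : CochainComplex (BanMod 𝒞 A) ℤ) : Prop :=
  ∀ i j k : ℤ, i + 1 = j → j + 1 = k → BanMod.StrictlyExactAt (K.d i j) (K.d j k)

/-- A morphism of complexes is a quasi-isomorphism if its mapping cone is strictly exact. -/
def IsQuasiIso {K L : CochainComplex (BanMod 𝒞 A) ℤ} (f : K ⟶ L) : Prop :=
  StrictlyExact (CochainComplex.mappingCone f)

/-- The complexes which are bounded above, in the homotopy category. -/
def boundedAbove (𝒞 : Ambient) (A : Type u) [NormedCommRing A] :
    ObjectProperty (HomotopyCategory (BanMod 𝒞 A) (ComplexShape.up ℤ)) :=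
  fun K => ∃ n : ℤ, CochainComplex.IsStrictlyLE K.as n

/-- The homotopy category of bounded above complexes of Banach modules. -/
abbrev KMinus (𝒞 : Ambient) (A : Type u) [NormedCommRing A] := (boundedAbove 𝒞 A).FullSubcategory

/-- The homotopy classes of quasi-isomorphisms. -/
def quasiIsos (𝒞 : Ambient) (A : Type u) [NormedCommRing A] : MorphismProperty (KMinus 𝒞 A) :=
  fun K L f => ∃ g : K.obj.as ⟶ L.obj.as,
    IsQuasiIso g ∧ (HomotopyCategory.quotient (BanMod 𝒞 A) (ComplexShape.up ℤ)).map g = f.hom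

/-- The bounded above derived category of Banach modules: the localization of the homotopy category
of bounded above complexes at the quasi-isomorphisms. -/
abbrev DMinus (𝒞 : Ambient) (A : Type u) [NormedCommRing A] := (quasiIsos 𝒞 A).Localization

/-- A chain complex `⋯ → X₂ → X₁ → X₀` regarded as an object of the homotopy category of bounded
above cochain complexes, with `Xₙ` in degree `-n`. -/
noncomputable def toKMinus (𝒞 : Ambient) (A : Type u) [NormedCommRing A] :
    ChainComplex (BanMod 𝒞 A) ℕ ⥤ KMinus 𝒞 A :=
  (boundedAbove 𝒞 A).lift
    (ComplexShape.embeddingDownNat.extendFunctor (BanMod 𝒞 A) ⋙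
      HomotopyCategory.quotient (BanMod 𝒞 A) (ComplexShape.up ℤ))
    (fun K => ⟨0, inferInstanceAs (CochainComplex.IsStrictlyLE
      (HomologicalComplex.extend K ComplexShape.embeddingDownNat) 0)⟩)

/-- A chain complex `⋯ → X₂ → X₁ → X₀` regarded as an object of the derived category. -/
noncomputable def toDMinus (𝒞 : Ambient) (A : Type u) [NormedCommRing A] :
    ChainComplex (BanMod 𝒞 A) ℕ ⥤ DMinus 𝒞 A :=
  toKMinus 𝒞 A ⋙ (quasiIsos 𝒞 A).Q

/-- A Banach module regarded as an object of the derived category, in degree `0`. -/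
noncomputable def moduleToDMinus (M : BanMod 𝒞 A) : DMinus 𝒞 A :=
  (toDMinus 𝒞 A).obj ((ChainComplex.single₀ (BanMod 𝒞 A)).obj M)

instance hasMapBifunctor (K L : ChainComplex (BanMod 𝒞 A) ℕ) :
    HomologicalComplex.HasMapBifunctor K L (BanMod.tensorFunctor 𝒞 A) (ComplexShape.down ℕ) :=
  fun n => by
    have : Finite ((ComplexShape.π (ComplexShape.down ℕ) (ComplexShape.down ℕ)
        (ComplexShape.down ℕ)) ⁻¹' {n}) :=
      Set.Finite.to_subtype ((Finset.finite_toSet (Finset.HasAntidiagonal.antidiagonal n)).subset fun p hp => by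
        simpa using hp)
    exact inferInstanceAs (HasCoproduct _)

theorem tensorMap_comp {M M' M'' N N' N'' : BanMod 𝒞 A} (f : M ⟶ M') (f' : M' ⟶ M'') (g : N ⟶ N')
    (g' : N' ⟶ N'') : BanMod.tensorMap f g ≫ BanMod.tensorMap f' g' =
      BanMod.tensorMap (f ≫ f') (g ≫ g') :=
  BanMod.tensor_hom_ext fun x y => by simp

theorem zero_tensorMap {M M' N N' : BanMod 𝒞 A} (g : N ⟶ N') :
    BanMod.tensorMap (0 : M ⟶ M') g = 0 := by
  have h := BanMod.add_tensorMap (0 : M ⟶ M') 0 g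
  rwa [add_zero, left_eq_add] at h

theorem tensorMap_zero {M M' N N' : BanMod 𝒞 A} (f : M ⟶ M') :
    BanMod.tensorMap f (0 : N ⟶ N') = 0 := by
  have h := BanMod.tensorMap_add f (0 : N ⟶ N') 0
  rwa [add_zero, left_eq_add] at h

variable [Ultra 𝒞 A]

/-- The total complex `Tot (P(M) ⊗̂_A P(N))`, where `P` is the functorial projective resolution. -/
noncomputable abbrev totTensor (M N : BanMod 𝒞 A) : ChainComplex (BanMod 𝒞 A) ℕ :=
  HomologicalComplex.mapBifunctor (BanMod.resolution M) (BanMod.resolution N)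
    (BanMod.tensorFunctor 𝒞 A) (ComplexShape.down ℕ)

/-- The derived tensor product `M ⊗̂ᴸ_A N` of Banach modules. -/
noncomputable def derivedTensor (M N : BanMod 𝒞 A) : DMinus 𝒞 A :=
  (toDMinus 𝒞 A).obj (totTensor M N)

/-- For a morphism `μ : M ⊗̂_A N → L`, the family of morphisms `P(M)ᵢ ⊗̂_A P(N)ⱼ → L` which is the
composite `P(M)₀ ⊗̂_A P(N)₀ → M ⊗̂_A N → L` for `i = j = 0` and zero otherwise. -/
noncomputable def totTensorComponent {M N L : BanMod 𝒞 A} (μ : BanMod.tensor M N ⟶ L) :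
    ∀ i j : ℕ, ((BanMod.tensorFunctor 𝒞 A).obj ((BanMod.resolution M).X i)).obj
      ((BanMod.resolution N).X j) ⟶ L
  | 0, 0 => BanMod.tensorMap (BanMod.augmentation M) (BanMod.augmentation N) ≫ μ
  | _ + 1, _ => 0
  | 0, _ + 1 => 0

/-- The degree `0` part of the morphism `Tot (P(M) ⊗̂_A P(N)) → L` induced by `μ`. -/
noncomputable def totTensorDesc {M N L : BanMod 𝒞 A} (μ : BanMod.tensor M N ⟶ L) :
    (totTensor M N).X 0 ⟶ L :=
  HomologicalComplex.mapBifunctorDesc fun i j _ => totTensorComponent μ i j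

theorem totTensor_d_desc {M N L : BanMod 𝒞 A} (μ : BanMod.tensor M N ⟶ L) :
    (totTensor M N).d 1 0 ≫ totTensorDesc μ = 0 := by
  refine HomologicalComplex.mapBifunctor.hom_ext fun i j h => ?_
  have h' : i + j = 1 := h
  rw [comp_zero]
  change HomologicalComplex.ιMapBifunctor _ _ _ _ i j 1 h ≫
    (HomologicalComplex.mapBifunctor.D₁ _ _ _ _ 1 0 +
      HomologicalComplex.mapBifunctor.D₂ _ _ _ _ 1 0) ≫ totTensorDesc μ = 0
  rw [Preadditive.add_comp, Preadditive.comp_add,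
    HomologicalComplex.mapBifunctor.ι_D₁_assoc, HomologicalComplex.mapBifunctor.ι_D₂_assoc]
  obtain ⟨rfl, rfl⟩ | ⟨rfl, rfl⟩ : (i = 1 ∧ j = 0) ∨ (i = 0 ∧ j = 1) := by omega
  · rw [HomologicalComplex.mapBifunctor.d₁_eq _ _ _ _ (i₁ := 1) (i₁' := 0) (by simp) 0 0 rfl,
      HomologicalComplex.mapBifunctor.d₂_eq_zero _ _ _ _ 1 0 0 (by simp), zero_comp, add_zero,
      Linear.units_smul_comp, Category.assoc, totTensorDesc,
      HomologicalComplex.ι_mapBifunctorDesc]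
    refine (congrArg _ ?_).trans (smul_zero _)
    change BanMod.tensorMap _ (𝟙 _) ≫ BanMod.tensorMap _ _ ≫ μ = 0
    rw [← Category.assoc, tensorMap_comp, BanMod.resolution_d_augmentation, zero_tensorMap,
      zero_comp]
  · rw [HomologicalComplex.mapBifunctor.d₂_eq _ _ _ _ 0 (i₂ := 1) (i₂' := 0) (by simp) 0 rfl,
      HomologicalComplex.mapBifunctor.d₁_eq_zero _ _ _ _ 0 1 0 (by simp), zero_comp, zero_add,
      Linear.units_smul_comp, Category.assoc, totTensorDesc,
      HomologicalComplex.ι_mapBifunctorDesc]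
    refine (congrArg _ ?_).trans (smul_zero _)
    change BanMod.tensorMap (𝟙 _) _ ≫ BanMod.tensorMap _ _ ≫ μ = 0
    rw [← Category.assoc, tensorMap_comp, BanMod.resolution_d_augmentation, tensorMap_zero,
      zero_comp]

/-- The morphism `Tot (P(M) ⊗̂_A P(N)) → L` of complexes induced by `μ : M ⊗̂_A N → L`. -/
noncomputable def totTensorMap {M N L : BanMod 𝒞 A} (μ : BanMod.tensor M N ⟶ L) :
    totTensor M N ⟶ (ChainComplex.single₀ (BanMod 𝒞 A)).obj L :=
  (ChainComplex.toSingle₀Equiv (totTensor M N) L).symm ⟨totTensorDesc μ, totTensor_d_desc μ⟩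

/-- The morphism `M ⊗̂ᴸ_A N → L` in the derived category induced by `μ : M ⊗̂_A N → L`. -/
noncomputable def derivedTensorMap {M N L : BanMod 𝒞 A} (μ : BanMod.tensor M N ⟶ L) :
    derivedTensor M N ⟶ moduleToDMinus L :=
  (toDMinus 𝒞 A).map (totTensorMap μ)

end Derived

/-! ## Banach algebras and homotopy epimorphisms -/

/-- A Banach `R`-algebra in the ambient category `𝒞`: a commutative `R`-algebra with a complete norm,
ultrametric if `𝒞 = nonarch`, such that the multiplication and the scalar multiplication are bounded.
Every Banach ring is isomorphic to one with submultiplicative norm, and we take the norm to be such. -/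
structure BanAlg (𝒞 : Ambient) (R : Type v) [NormedCommRing R] where
  carrier : Type u
  [normedCommRing : NormedCommRing carrier]
  [algebra : Algebra R carrier]
  [bddSMul : BddSMul R carrier]
  [complete : CompleteSpace carrier]
  [ultra : Ultra 𝒞 carrier]

namespace BanAlg

variable {𝒞 : Ambient} {R : Type v} [NormedCommRing R]

instance : CoeSort (BanAlg.{u} 𝒞 R) (Type u) := ⟨carrier⟩

attribute [instance] normedCommRing algebra bddSMul complete ultra

/-- The category of Banach `R`-algebras and bounded `R`-algebra homomorphisms. -/
instance : Category (BanAlg.{u} 𝒞 R) where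
  Hom A B := {f : A →ₐ[R] B // IsBdd f}
  id A := ⟨AlgHom.id R A, 1, by simp⟩
  comp f g := ⟨g.1.comp f.1, by
    obtain ⟨C, hC⟩ := f.2
    obtain ⟨D, hD⟩ := g.2
    refine ⟨D * C, fun x => (hD _).trans ?_⟩
    rw [NNReal.coe_mul, mul_assoc]
    exact mul_le_mul_of_nonneg_left (hC x) D.2⟩

/-- The algebra homomorphism underlying a morphism. -/
def Hom.alg {A B : BanAlg.{u} 𝒞 R} (π : A ⟶ B) : A →ₐ[R] B := π.1

/-- The target of a morphism `π : A → B` as a Banach `A`-module via `π`. -/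
def asModule {A B : BanAlg.{u} 𝒞 R} (π : A ⟶ B) : BanMod 𝒞 A :=
  letI : Module A B := (Hom.alg π).toRingHom.toModule
  { carrier := B
    bddSMul := by
      obtain ⟨C, hC⟩ := π.2
      refine ⟨C, fun a b => (norm_mul_le (Hom.alg π a) b).trans ?_⟩
      exact mul_le_mul_of_nonneg_right (hC a) (norm_nonneg b) }

/-- The multiplication `B ⊗̂_A B → B`. -/
noncomputable def mul {A B : BanAlg.{u} 𝒞 R} (π : A ⟶ B) :
    BanMod.tensor (asModule π) (asModule π) ⟶ asModule π :=
  BanMod.tensorLift (M := asModule π) (N := asModule π) (P := asModule π)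
    (LinearMap.mk₂ A (fun x y : B => (x * y : B))
      (fun x x' y => add_mul (R := B) x x' y)
      (fun a x y => mul_assoc (G := B) (Hom.alg π a) x y)
      (fun x y y' => mul_add (R := B) x y y')
      (fun a x y => mul_left_comm (G := B) x (Hom.alg π a) y))
    ⟨1, fun x y => (norm_mul_le (α := B) x y).trans_eq (one_mul _).symm⟩

/-- A morphism `π : A → B` of Banach `R`-algebras is a homotopy epimorphism if the multiplication
`B ⊗̂ᴸ_A B → B` is an isomorphism in the bounded above derived category of Banach `A`-modules. -/
def IsHomotopyEpi {A B : BanAlg.{u} 𝒞 R} (π : A ⟶ B) : Prop :=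
  IsIso (derivedTensorMap (mul π))

end BanAlg

/-! ## Algebras of continuous functions -/

section ContinuousFunctions

variable (𝒞 : Ambient) (R : Type v) [NormedField R] [CompleteSpace R] [Ultra 𝒞 R]

/-- The Banach `R`-algebra `C(X, R)` with the supremum norm. -/
noncomputable def contAlg (X : Type u) [TopologicalSpace X] [CompactSpace X] : BanAlg.{max u v} 𝒞 R where
  carrier := C(X, R)
  bddSMul := ⟨1, fun a f => by simpa using norm_smul_le a f⟩
  ultra := ⟨fun h => by
    have := Ultra.isUltrametricDist (𝒞 := 𝒞) (E := R) h
    infer_instance⟩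

variable {X : Type u} [TopologicalSpace X] [CompactSpace X]

instance (K : TopologicalSpace.Closeds X) : CompactSpace K :=
  isCompact_iff_compactSpace.1 K.isClosed.isCompact

/-- The restriction map `C(X, R) → C(K, R)` for a closed subset `K` of `X`. -/
noncomputable def restriction (K : TopologicalSpace.Closeds X) : contAlg 𝒞 R X ⟶ contAlg 𝒞 R K :=
  ⟨ContinuousMap.compRightAlgHom R R ⟨(Subtype.val : K → X), continuous_subtype_val⟩, 1, fun f => by
    rw [NNReal.coe_one, one_mul]
    exact (ContinuousMap.norm_le _ (norm_nonneg f)).2 fun x => ContinuousMap.norm_coe_le_norm f x.1⟩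

end ContinuousFunctions

/-! ## Admissible triples -/

/-- A non-Archimedean local field: a normed field whose norm is ultrametric and non-trivial and whose
topology is locally compact. -/
def IsNonarchLocalField (R : Type v) [NormedField R] : Prop :=
  IsUltrametricDist R ∧ (∃ x : R, x ≠ 0 ∧ ‖x‖ ≠ 1) ∧ LocallyCompactSpace R

/-- The admissible pairs: `R` is `ℝ` or `ℂ` with the usual absolute value in the Archimedean case, and
a finite field with trivial norm or a local field in the non-Archimedean case. -/
def IsAdmissiblePair (𝒞 : Ambient) (R : Type v) [NormedField R] : Prop :=
  match 𝒞 with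
  | .arch => (∃ e : R ≃+* ℝ, ∀ x, ‖e x‖ = ‖x‖) ∨ (∃ e : R ≃+* ℂ, ∀ x, ‖e x‖ = ‖x‖)
  | .nonarch => (Finite R ∧ ∀ x : R, x ≠ 0 → ‖x‖ = 1) ∨ IsNonarchLocalField R

/-- The admissible triples: moreover `X` is totally disconnected in the non-Archimedean case. -/
def IsAdmissibleTriple (𝒞 : Ambient) (X : Type u) [TopologicalSpace X] (R : Type v)
    [NormedField R] : Prop :=
  IsAdmissiblePair 𝒞 R ∧ (𝒞 = .nonarch → TotallyDisconnectedSpace X)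

end BanachGeometry

/-!
A homomorphism `A → B` which admits bounded lifts is a homotopy epimorphism as soon as its
kernel has a bounded approximate identity `1 - u`. Indeed, an element `m` of a Banach `A`-module
with `1 ⊗ m = 0` in `B ⊗̂ M` satisfies `u m → 0`, and replacing `m` by `u m` does not change
`1 ⊗ m`, so strict exactness passes from `M` to `B ⊗̂ M`; it also passes to `ℓ(Z, A) ⊗̂ M`.
Comparing `Tot (P(B) ⊗̂ P(B))` with `P(B) ⊗̂ B` column by column, and `P(B) ⊗̂ B` with
`B ⊗̂ B ≅ B`, shows that `B ⊗̂ᴸ B → B` is a quasi-isomorphism. For `A = C(X, R)` and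
`B = C(K, R)` everything follows from extending functions on closed subsets of `X` with control
of the norm: the `u` are the extensions of the function equal to `1` on `K` and to `0` off ever
smaller neighbourhoods of `K`.
-/

namespace BanachGeometry

theorem exists_pos_mul_le (c : ℝ≥0) {ε : ℝ} (hε : 0 < ε) : ∃ δ : ℝ, 0 < δ ∧ c * δ ≤ ε := by
  obtain ⟨δ, hδ, h⟩ := exists_pos_mul_lt hε (c : ℝ)
  exact ⟨δ, hδ, h.le⟩

section SuccessiveApproximation

variable {E F : Type*} [NormedAddCommGroup E] [NormedAddCommGroup F]

theorem exists_seq_of_approx_preimage (f : E →+ F) {D : ℝ} (hD : 0 ≤ D)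
    (h : ∀ y, ∃ x, ‖x‖ ≤ D * ‖y‖ ∧ ‖y - f x‖ ≤ ‖y‖ / 2) (y : F) :
    ∃ x : ℕ → E, ∀ n, ‖x n‖ ≤ D * ‖y‖ * (1 / 2) ^ n ∧
      ‖y - f (∑ i ∈ Finset.range n, x i)‖ ≤ ‖y‖ * (1 / 2) ^ n := by
  choose φ hφD hφ using h
  let r : ℕ → F := fun n => (fun z => z - f (φ z))^[n] y
  have r_succ (n : ℕ) : r (n + 1) = r n - f (φ (r n)) := Function.iterate_succ_apply' _ n y
  have r_eq (n : ℕ) : y - f (∑ i ∈ Finset.range n, φ (r i)) = r n := by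
    induction n with
    | zero => simp [r]
    | succ n ih => rw [Finset.sum_range_succ, map_add, ← sub_sub, ih, r_succ]
  have norm_r (n : ℕ) : ‖r n‖ ≤ ‖y‖ * (1 / 2) ^ n := by
    induction n with
    | zero => simp [r]
    | succ n ih =>
      rw [r_succ, pow_succ]
      linarith [hφ (r n)]
  refine ⟨fun n => φ (r n), fun n => ⟨(hφD _).trans ?_, (r_eq n).symm ▸ norm_r n⟩⟩
  rw [mul_assoc]
  exact mul_le_mul_of_nonneg_left (norm_r n) hD

theorem exists_preimage_of_approx_preimage [CompleteSpace E] (f : E →+ F) (hf : Continuous f)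
    {D : ℝ} (hD : 0 ≤ D) (h : ∀ y, ∃ x, ‖x‖ ≤ D * ‖y‖ ∧ ‖y - f x‖ ≤ ‖y‖ / 2) (y : F) :
    ∃ x, f x = y ∧ ‖x‖ ≤ 2 * D * ‖y‖ := by
  obtain ⟨x, hx⟩ := exists_seq_of_approx_preimage f hD h y
  have hgeom : HasSum (fun n : ℕ => D * ‖y‖ * (1 / 2) ^ n) (D * ‖y‖ * 2) :=
    hasSum_geometric_two.mul_left _
  have hsum : Summable x := .of_norm_bounded hgeom.summable fun n => (hx n).1
  have hlim : Filter.Tendsto (fun n => y - f (∑ i ∈ Finset.range n, x i)) Filter.atTop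
      (nhds (y - f (∑' n, x n))) :=
    tendsto_const_nhds.sub ((hf.tendsto _).comp hsum.hasSum.tendsto_sum_nat)
  have hlim' : Filter.Tendsto (fun n => y - f (∑ i ∈ Finset.range n, x i)) Filter.atTop
      (nhds 0) := by
    refine squeeze_zero_norm (fun n => (hx n).2) ?_
    simpa using (tendsto_pow_atTop_nhds_zero_of_lt_one (r := (1 / 2 : ℝ)) (by norm_num)
      (by norm_num)).const_mul ‖y‖
  refine ⟨∑' n, x n, (sub_eq_zero.1 (tendsto_nhds_unique hlim hlim')).symm, ?_⟩
  linarith [tsum_of_norm_bounded hgeom fun n => (hx n).1]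

end SuccessiveApproximation

namespace BanMod

/-! ## Strict exactness -/

section StrictExactness

variable {𝒞 : Ambient} {A : Type u} [NormedCommRing A] {M N P Q : BanMod 𝒞 A}

theorem lin_lin_eq_zero {f : M ⟶ N} {g : N ⟶ P} (h : f ≫ g = 0) (x : M) :
    Hom.lin g (Hom.lin f x) = 0 := by
  rw [← lin_comp, h, lin_zero]

theorem isStrict_zero : IsStrict (0 : M ⟶ N) := by
  refine ⟨?_, 0, fun x => ⟨0, map_zero _, by simp⟩⟩
  rw [show Set.range (Hom.lin (0 : M ⟶ N)) = {0} from Set.range_const]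
  exact isClosed_singleton

/-- Every `y ∈ s` has a preimage under `f` whose norm is at most a constant multiple of `‖y‖`. This
is the quantitative form of surjectivity onto `s` in terms of which strict exactness is proved. -/
def HasBddLifts (f : M ⟶ N) (s : Set N) : Prop :=
  ∃ C : ℝ≥0, ∀ y ∈ s, ∃ x, Hom.lin f x = y ∧ ‖x‖ ≤ C * ‖y‖

theorem HasBddLifts.mono {f : M ⟶ N} {s t : Set N} (h : HasBddLifts f t) (hst : s ⊆ t) :
    HasBddLifts f s :=
  let ⟨C, hC⟩ := h
  ⟨C, fun y hy => hC y (hst hy)⟩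

theorem strictlyExactAt_iff {f : M ⟶ N} {g : N ⟶ P} :
    StrictlyExactAt f g ↔ f ≫ g = 0 ∧ HasBddLifts f {y | Hom.lin g y = 0} := by
  constructor
  · rintro ⟨⟨hcl, C, hC⟩, hr⟩
    rw [hcl.closure_eq] at hr
    refine ⟨hom_ext fun x => ?_, C, fun y hy => ?_⟩
    · rw [lin_comp, lin_zero]
      exact hr.subset ⟨x, rfl⟩
    · obtain ⟨x, rfl⟩ := hr.superset hy
      exact hC x
  · rintro ⟨h0, C, hC⟩
    have hr : Set.range (Hom.lin f) = {y | Hom.lin g y = 0} := by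
      refine Set.Subset.antisymm (Set.range_subset_iff.2 (lin_lin_eq_zero h0)) fun y hy => ?_
      obtain ⟨x, hx, -⟩ := hC y hy
      exact ⟨x, hx⟩
    have hcl : IsClosed (Set.range (Hom.lin f)) :=
      hr ▸ isClosed_singleton.preimage (continuous_lin g)
    exact ⟨⟨hcl, C, fun x => hC _ (lin_lin_eq_zero h0 x)⟩, hcl.closure_eq.trans hr⟩

theorem StrictlyExactAt.comp_eq_zero {f : M ⟶ N} {g : N ⟶ P} (h : StrictlyExactAt f g) :
    f ≫ g = 0 :=
  (strictlyExactAt_iff.1 h).1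

theorem StrictlyExactAt.hasBddLifts {f : M ⟶ N} {g : N ⟶ P} (h : StrictlyExactAt f g) :
    HasBddLifts f {y | Hom.lin g y = 0} :=
  (strictlyExactAt_iff.1 h).2

theorem strictlyExactAt_zero_iff {f : M ⟶ N} :
    StrictlyExactAt f (0 : N ⟶ P) ↔ HasBddLifts f Set.univ := by
  simp only [strictlyExactAt_iff, comp_zero, lin_zero, true_and, Set.ofPred_true]

theorem StrictlyExactAt.exists_norm_sub_le {f : M ⟶ N} {g : N ⟶ P} (hfg : StrictlyExactAt f g)
    (hg : IsStrict g) :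
    ∃ C : ℝ≥0, ∀ y, ∃ x, ‖x‖ ≤ C * ‖y‖ ∧ ‖y - Hom.lin f x‖ ≤ C * ‖Hom.lin g y‖ := by
  obtain ⟨C, hC⟩ := hfg.hasBddLifts
  obtain ⟨-, D, hD⟩ := hg
  obtain ⟨L, hL⟩ := Hom.isBdd g
  refine ⟨max (C * (1 + D * L)) D, fun y => ?_⟩
  obtain ⟨y', hy', hy'D⟩ := hD y
  obtain ⟨x, hx, hxC⟩ := hC (y - y') (by rw [Set.mem_ofPred, map_sub, hy', sub_self])
  refine ⟨x, hxC.trans ?_, ?_⟩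
  · calc C * ‖y - y'‖ ≤ C * (‖y‖ + D * (L * ‖y‖)) := by
          gcongr
          exact (norm_sub_le _ _).trans (by gcongr; exact hy'D.trans (by gcongr; exact hL y))
      _ = (C * (1 + D * L) : ℝ≥0) * ‖y‖ := by push_cast; ring
      _ ≤ _ := by gcongr; exact le_max_left _ _
  · rw [hx, sub_sub_cancel]
    exact hy'D.trans (by gcongr; exact le_max_right _ _)

theorem strictlyExactAt_of_approx {f : M ⟶ N} {g : N ⟶ P} (h0 : f ≫ g = 0) (C : ℝ≥0)
    (h : ∀ y, ∀ ε : ℝ, 0 < ε → ∃ x, ‖x‖ ≤ C * ‖y‖ + ε ∧ ‖y - Hom.lin f x‖ ≤ C * ‖Hom.lin g y‖ + ε) :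
    StrictlyExactAt f g := by
  let f' : M →ₗ[A] LinearMap.ker (Hom.lin g) :=
    (Hom.lin f).codRestrict _ (lin_lin_eq_zero h0)
  have hf' : Continuous f' := (continuous_lin f).subtype_mk _
  have happrox (y : LinearMap.ker (Hom.lin g)) :
      ∃ x, ‖x‖ ≤ (C + 1 : ℝ) * ‖y‖ ∧ ‖y - f' x‖ ≤ ‖y‖ / 2 := by
    obtain rfl | hy := eq_or_ne y 0
    · exact ⟨0, by simp, by simp⟩
    · have hpos : 0 < ‖y‖ := norm_pos_iff.2 hy
      obtain ⟨x, hx, hxy⟩ := h y (‖y‖ / 2) (half_pos hpos)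
      rw [show Hom.lin g y = 0 from y.2, norm_zero, mul_zero, zero_add] at hxy
      refine ⟨x, hx.trans ?_, hxy⟩
      rw [← Submodule.coe_norm]
      linarith
  refine strictlyExactAt_iff.2 ⟨h0, 2 * (C + 1), fun y hy => ?_⟩
  obtain ⟨x, hx, hxy⟩ := exists_preimage_of_approx_preimage f'.toAddMonoidHom hf'
    (by positivity) happrox ⟨y, hy⟩
  exact ⟨x, congrArg Subtype.val hx, by exact_mod_cast hxy⟩

theorem strictlyExactAt_of_dense {f : M ⟶ N} {g : N ⟶ P} (h0 : f ≫ g = 0) {s : Set N}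
    (hs : Dense s) (C : ℝ≥0)
    (h : ∀ y ∈ s, ∀ ε : ℝ, 0 < ε →
      ∃ x, ‖x‖ ≤ C * ‖y‖ + ε ∧ ‖y - Hom.lin f x‖ ≤ C * ‖Hom.lin g y‖ + ε) :
    StrictlyExactAt f g := by
  refine strictlyExactAt_of_approx h0 C fun y ε hε => ?_
  obtain ⟨L, hL⟩ := Hom.isBdd g
  obtain ⟨η, hη, hηε⟩ := exists_pos_mul_le (1 + C + C * L) (half_pos hε)
  obtain ⟨y', hdist, hy'⟩ := Metric.dense_iff.1 hs y η hη
  obtain ⟨x, hx, hxy⟩ := h y' hy' (ε / 2) (half_pos hε)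
  have hd : ‖y' - y‖ ≤ η := dist_eq_norm y' y ▸ (Metric.mem_ball.1 hdist).le
  have hnorm : ‖y'‖ ≤ ‖y‖ + η := by linarith [norm_le_norm_add_norm_sub' y' y]
  have hgnorm : ‖Hom.lin g y'‖ ≤ ‖Hom.lin g y‖ + L * η := by
    refine (norm_le_norm_add_norm_sub' _ (Hom.lin g y)).trans ?_
    rw [← map_sub]
    gcongr
    exact (hL _).trans (by gcongr)
  have hsub : ‖y - Hom.lin f x‖ ≤ η + ‖y' - Hom.lin f x‖ :=
    (norm_sub_le_norm_sub_add_norm_sub y y' _).trans (by rw [norm_sub_rev]; gcongr)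
  have hC : (C : ℝ) * ‖y'‖ ≤ C * (‖y‖ + η) := by gcongr
  have hCg : (C : ℝ) * ‖Hom.lin g y'‖ ≤ C * (‖Hom.lin g y‖ + L * η) := by gcongr
  have hCη : 0 ≤ (C : ℝ) * η := by positivity
  have hCLη : 0 ≤ (C : ℝ) * L * η := by positivity
  push_cast at hηε
  exact ⟨x, by linarith, by linarith⟩

theorem StrictlyExactAt.comp_kerι {h : P ⟶ Q} {f : M ⟶ N} {g : N ⟶ ker h}
    (hfg : StrictlyExactAt f g) : StrictlyExactAt f (g ≫ kerι h) := by
  obtain ⟨h0, C, hC⟩ := strictlyExactAt_iff.1 hfg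
  exact strictlyExactAt_iff.2 ⟨by rw [← Category.assoc, h0, zero_comp], C,
    fun y hy => hC y (Subtype.ext hy)⟩

theorem StrictlyExactAt.comp_kerι_of_surjective {g : N ⟶ P} {f : M ⟶ ker g}
    (hf : StrictlyExactAt f (0 : ker g ⟶ Q)) : StrictlyExactAt (f ≫ kerι g) g := by
  obtain ⟨C, hC⟩ := strictlyExactAt_zero_iff.1 hf
  refine strictlyExactAt_iff.2
    ⟨by rw [Category.assoc, kerι_comp, comp_zero], C, fun y hy => ?_⟩
  obtain ⟨x, hx, hxy⟩ := hC ⟨y, hy⟩ trivial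
  exact ⟨x, congrArg Subtype.val hx, hxy⟩

end StrictExactness

/-! ## The functorial resolution -/

section Resolution

variable {𝒞 : Ambient} {A : Type u} [NormedCommRing A] [Ultra 𝒞 A] {M : BanMod 𝒞 A}

/-- The generator of `ℓ(M, A)` at `x`. -/
noncomputable def gen (x : M) : free M :=
  toComplete (E := PreFree 𝒞 A M) (Finsupp.single x 1 : M →₀ A)

theorem norm_gen_le (x : M) : ‖gen x‖ ≤ ‖(1 : A)‖₊ * ‖x‖ := by
  refine (norm_toComplete (E := PreFree 𝒞 A M) (Finsupp.single x 1 : M →₀ A)).trans_le ?_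
  have hsupp := PreFree.seminorm_eq (𝒞 := 𝒞) (f := (Finsupp.single x 1 : M →₀ A)) (s := {x})
    Finsupp.support_single_subset
  have hval : PreFree.toFinsupp (𝒞 := 𝒞) (Finsupp.single x 1 : M →₀ A) x = 1 :=
    Finsupp.single_eq_same
  refine (congrArg NNReal.toReal hsupp).trans_le ?_
  cases 𝒞 <;> simp [agg, hval]

theorem counit_gen (x : M) : Hom.lin (counit M) (gen x) = x :=
  (completeLift_coe (E := PreFree 𝒞 A M) _ _ _).trans <|
    (Finsupp.linearCombination_single A 1 x).trans (one_smul A x)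

theorem strictlyExactAt_counit_zero (M P : BanMod 𝒞 A) :
    StrictlyExactAt (counit M) (0 : M ⟶ P) :=
  strictlyExactAt_zero_iff.2 ⟨‖(1 : A)‖₊, fun x _ => ⟨gen x, counit_gen x, norm_gen_le x⟩⟩

theorem hasBddLifts_augmentation (M : BanMod 𝒞 A) : HasBddLifts (augmentation M) Set.univ :=
  strictlyExactAt_zero_iff.1 (strictlyExactAt_counit_zero M M)

theorem isStrict_augmentation (M : BanMod 𝒞 A) : IsStrict (augmentation M) :=
  (strictlyExactAt_counit_zero M M).1

theorem resolution_d (M : BanMod 𝒞 A) (n : ℕ) :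
    (resolution M).d (n + 1) n = counit (syzygy M (n + 1)) ≫ syzygyι M n :=
  ChainComplex.of_d (fun n => free (syzygy M n))
    (fun n => counit (syzygy M (n + 1)) ≫ syzygyι M n) n

theorem strictlyExactAt_augmentation (M : BanMod 𝒞 A) :
    StrictlyExactAt ((resolution M).d 1 0) (augmentation M) := by
  rw [resolution_d]
  exact (strictlyExactAt_counit_zero _ M).comp_kerι_of_surjective

theorem isStrict_resolution_d (M : BanMod 𝒞 A) (n : ℕ) : IsStrict ((resolution M).d (n + 1) n) := by
  rw [resolution_d]
  exact (strictlyExactAt_counit_zero (syzygy M (n + 1)) M).comp_kerι_of_surjective.1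

theorem strictlyExactAt_resolution (M : BanMod 𝒞 A) (n : ℕ) :
    StrictlyExactAt ((resolution M).d (n + 2) (n + 1)) ((resolution M).d (n + 1) n) := by
  rw [resolution_d, resolution_d]
  exact (strictlyExactAt_counit_zero (syzygy M (n + 2)) M).comp_kerι_of_surjective.comp_kerι

end Resolution

end BanMod

/-! ## Tensor products with free modules -/

section Agg

variable {𝒞 : Ambient} {ι κ : Type*}

theorem agg_comm (s : Finset ι) (t : Finset κ) (w : ι → κ → ℝ≥0) :
    agg 𝒞 s (fun i => agg 𝒞 t (w i)) = agg 𝒞 t (fun j => agg 𝒞 s (w · j)) := by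
  cases 𝒞
  · exact Finset.sum_comm
  · exact Finset.sup_comm s t w

theorem agg_mono_set {s t : Finset ι} (h : s ⊆ t) (w : ι → ℝ≥0) : agg 𝒞 s w ≤ agg 𝒞 t w := by
  cases 𝒞
  · exact Finset.sum_le_sum_of_subset h
  · exact Finset.sup_mono h

theorem agg_mul (s : Finset ι) (w : ι → ℝ≥0) (c : ℝ≥0) :
    agg 𝒞 s w * c = agg 𝒞 s (fun i => w i * c) := by
  cases 𝒞
  · exact Finset.sum_mul ..
  · exact NNReal.finset_sup_mul ..

theorem agg_map (s : Finset ι) (e : ι ↪ κ) (w : κ → ℝ≥0) :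
    agg 𝒞 (s.map e) w = agg 𝒞 s (fun i => w (e i)) := by
  cases 𝒞
  · exact Finset.sum_map s e w
  · exact Finset.sup_map s e w

theorem continuous_agg {T : Type*} [TopologicalSpace T] (s : Finset ι) {w : ι → T → ℝ≥0}
    (h : ∀ i ∈ s, Continuous (w i)) : Continuous fun x => agg 𝒞 s (w · x) := by
  cases 𝒞
  · exact continuous_finsetSum s h
  · exact Continuous.finset_sup_apply h

end Agg

namespace BanMod

section Tensor

variable {𝒞 : Ambient} {A : Type u} [NormedCommRing A] {M N : BanMod 𝒞 A}

theorem tensor_eq_top (H : AddSubgroup (tensor M N)) (hH : IsClosed (H : Set (tensor M N)))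
    (h : ∀ x y, tmul x y ∈ H) : H = ⊤ := by
  refine (AddSubgroup.eq_top_iff' H).2 fun t =>
    UniformSpace.Completion.induction_on (α := PreTensor 𝒞 A M N) (p := (· ∈ H)) t hH fun t => ?_
  induction t using TensorProduct.induction_on with
  | zero => exact H.zero_mem
  | tmul x y => exact h x y
  | add s t hs ht =>
    exact (congrArg (· ∈ H)
      (map_add (toCompleteLin 𝒞 A (PreTensor 𝒞 A M N)) s t)).mpr (H.add_mem hs ht)

/-- The homomorphism `x ↦ x ⊗ y`. -/
noncomputable def tmulRight (M : BanMod 𝒞 A) (y : N) : M →+ tensor M N :=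
  AddMonoidHom.mk' (tmul · y) fun x x' => add_tmul x x' y

theorem zero_tmul (y : N) : tmul (0 : M) y = 0 :=
  map_zero (tmulRight M y)

theorem sub_tmul (x x' : M) (y : N) : tmul (x - x') y = tmul x y - tmul x' y :=
  map_sub (tmulRight M y) x x'

/-- The homomorphism `y ↦ x ⊗ y`. -/
noncomputable def tmulLeft (N : BanMod 𝒞 A) (x : M) : N →+ tensor M N :=
  AddMonoidHom.mk' (tmul x) (tmul_add x)

theorem smul_tmul (a : A) (x : M) (y : N) : tmul (a • x) y = tmul x (a • y) :=
  congrArg (toComplete (𝒞 := 𝒞) (A := A) (E := PreTensor 𝒞 A M N)) (TensorProduct.smul_tmul a x y)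

theorem tensor_le_of_tmul_le (p : tensor M N → ℝ≥0) (hp : Continuous p)
    (hsum : ∀ (n : ℕ) (t : Fin n → tensor M N), p (∑ i, t i) ≤ agg 𝒞 Finset.univ fun i => p (t i))
    (C : ℝ≥0) (h : ∀ x y, p (tmul x y) ≤ C * (‖x‖₊ * ‖y‖₊)) (t : tensor M N) :
    p t ≤ C * ‖t‖₊ := by
  refine UniformSpace.Completion.induction_on (α := PreTensor 𝒞 A M N)
    (p := fun t : tensor M N => p t ≤ C * ‖t‖₊) t (isClosed_le hp (by fun_prop)) fun t => ?_
  have hnorm : ‖(toComplete t : tensor M N)‖₊ = sInf (PreTensor.sizes t) :=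
    NNReal.eq (norm_toComplete t)
  change p (toComplete t) ≤ C * ‖(toComplete t : tensor M N)‖₊
  rw [hnorm, Monotone.map_csInf_of_continuousAt (f := (C * ·)) (by fun_prop)
    (fun _ _ hab => mul_le_mul_right hab C) (PreTensor.sizes_nonempty t)]
  refine le_csInf ((PreTensor.sizes_nonempty t).image _) (Set.forall_mem_image.2 ?_)
  rintro _ ⟨n, m, k, rfl, rfl⟩
  have hmap : (toComplete (∑ i, m i ⊗ₜ[A] k i : M ⊗[A] N) : tensor M N) = ∑ i, tmul (m i) (k i) :=
    map_sum (toCompleteLin 𝒞 A (PreTensor 𝒞 A M N)) _ _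
  rw [hmap]
  exact (hsum n _).trans (agg_le_mul _ _ _ _ fun i _ => h _ _)

theorem continuous_tmul_left (y : N) : Continuous fun x : M => tmul x y :=
  AddMonoidHomClass.continuous_of_bound (tmulRight M y) ‖y‖ fun x =>
    (norm_tmul_le x y).trans_eq (mul_comm _ _)

end Tensor

section FreeTensor

variable {𝒞 : Ambient} {A : Type u} [NormedCommRing A] [Ultra 𝒞 A] {Z M : BanMod 𝒞 A}

theorem gen_zero : gen (0 : Z) = 0 :=
  norm_le_zero_iff.1 ((norm_gen_le 0).trans_eq (by rw [norm_zero, mul_zero]))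

theorem toComplete_single (z : Z) (a : A) :
    toComplete (E := PreFree 𝒞 A Z) (Finsupp.single z a : Z →₀ A) = a • gen z :=
  (congrArg (toComplete (E := PreFree 𝒞 A Z))
    (Finsupp.smul_single_one z a).symm).trans (map_smul (toCompleteLin 𝒞 A (PreFree 𝒞 A Z)) a _)

theorem free_induction {p : free Z → Prop} (hp : IsClosed {x | p x})
    (add : ∀ x y, p x → p y → p (x + y)) (smul_gen : ∀ (a : A) (z : Z), p (a • gen z))
    (x : free Z) : p x := by
  refine UniformSpace.Completion.induction_on (α := PreFree 𝒞 A Z) x hp fun f => ?_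
  let ι : (Z →₀ A) →ₗ[A] free Z := toCompleteLin 𝒞 A (PreFree 𝒞 A Z)
  have hι (z : Z) (a : A) : ι (.single z a) = a • gen z := toComplete_single z a
  refine Finsupp.induction_linear (motive := fun f => p (ι f)) f ?_ (fun f g hf hg => ?_)
    fun z a => hι z a ▸ smul_gen a z
  · simpa only [zero_smul, map_zero] using smul_gen 0 0
  · exact (map_add ι f g).symm ▸ add _ _ hf hg

theorem agg_nnnorm_smul_le {D : ℝ≥0} (hD : ∀ (a : A) (m : M), ‖a • m‖₊ ≤ D * ‖a‖₊ * ‖m‖₊)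
    (s : Finset {z : Z // z ≠ 0}) (f : PreFree 𝒞 A Z) (m : M) :
    agg 𝒞 s (fun z => ‖PreFree.toFinsupp f z • m‖₊ * ‖z.1‖₊) ≤ D * ‖m‖₊ * ‖f‖₊ := by
  classical
  let t := s.map (.subtype _) ∪ (PreFree.toFinsupp f).support
  calc agg 𝒞 s (fun z => ‖PreFree.toFinsupp f z • m‖₊ * ‖z.1‖₊)
    _ = agg 𝒞 (s.map (.subtype _)) (fun z => ‖PreFree.toFinsupp f z • m‖₊ * ‖z‖₊) :=
      (agg_map s (.subtype _) (fun z => ‖PreFree.toFinsupp f z • m‖₊ * ‖z‖₊)).symm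
    _ ≤ agg 𝒞 t (fun z => ‖PreFree.toFinsupp f z • m‖₊ * ‖z‖₊) :=
      agg_mono_set Finset.subset_union_left _
    _ ≤ D * ‖m‖₊ * agg 𝒞 t (fun z => ‖PreFree.toFinsupp f z‖₊ * ‖z‖₊) :=
      agg_le_mul _ _ _ _ fun z _ => by
        rw [← mul_assoc, mul_right_comm D]
        exact mul_le_mul_left (hD _ _) _
    _ = D * ‖m‖₊ * ‖f‖₊ := by
      rw [← PreFree.seminorm_eq (f := f) Finset.subset_union_right]
      rfl

/-- The morphism `ℓ(Z, A) → M` sending `x` to `x_z m`. The coefficient `x_z` is well defined on the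
completion only for `z ≠ 0`, since the summand at `0` has zero norm. -/
noncomputable def coeffSMul (z : {z : Z // z ≠ 0}) (m : M) : free Z ⟶ M :=
  completeLift (E := PreFree 𝒞 A Z)
    (LinearMap.toSpanSingleton A M m ∘ₗ (Finsupp.lapply z.1 : (Z →₀ A) →ₗ[A] A)) <| by
    obtain ⟨D, hD⟩ := M.bddSMul.exists_bound
    have hz : 0 < ‖z.1‖₊ := nnnorm_pos.2 z.2
    refine ⟨D * ‖m‖₊ / ‖z.1‖₊, fun f => ?_⟩
    have hle : ‖PreFree.toFinsupp f z • m‖₊ * ‖z.1‖₊ ≤ D * ‖m‖₊ * ‖f‖₊ := by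
      refine le_of_eq_of_le ?_ (agg_nnnorm_smul_le hD {z} f m)
      cases 𝒞 <;> simp [agg]
    exact NNReal.coe_le_coe.2 <| (le_div_iff₀ hz).2 hle |>.trans_eq (mul_div_right_comm _ _ _)

theorem coeffSMul_coe (z : {z : Z // z ≠ 0}) (m : M) (f : PreFree 𝒞 A Z) :
    Hom.lin (coeffSMul z m) (toComplete f) = PreFree.toFinsupp f z • m :=
  completeLift_coe (E := PreFree 𝒞 A Z) _ _ f

theorem coeffSMul_gen (z : {z : Z // z ≠ 0}) (z' : Z) (m : M) :
    Hom.lin (coeffSMul z m) (gen z') = Finsupp.single z' (1 : A) z.1 • m :=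
  coeffSMul_coe z m _

theorem agg_nnnorm_coeffSMul_le {D : ℝ≥0} (hD : ∀ (a : A) (m : M), ‖a • m‖₊ ≤ D * ‖a‖₊ * ‖m‖₊)
    (s : Finset {z : Z // z ≠ 0}) (x : free Z) (m : M) :
    agg 𝒞 s (fun z => ‖Hom.lin (coeffSMul z m) x‖₊ * ‖z.1‖₊) ≤ D * (‖x‖₊ * ‖m‖₊) := by
  refine UniformSpace.Completion.induction_on (α := PreFree 𝒞 A Z) (p := fun x : free Z =>
    agg 𝒞 s (fun z => ‖Hom.lin (coeffSMul z m) x‖₊ * ‖z.1‖₊) ≤ D * (‖x‖₊ * ‖m‖₊)) x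
    (isClosed_le (continuous_agg s fun z _ => (continuous_lin _).nnnorm.mul continuous_const)
      (by fun_prop)) fun f => ?_
  have hnorm : ‖(toComplete f : free Z)‖₊ = ‖f‖₊ := NNReal.eq (norm_toComplete f)
  change agg 𝒞 s (fun z => ‖Hom.lin (coeffSMul z m) (toComplete f)‖₊ * ‖z.1‖₊) ≤
    D * (‖(toComplete f : free Z)‖₊ * ‖m‖₊)
  rw [hnorm, mul_comm ‖f‖₊, ← mul_assoc]
  simpa only [coeffSMul_coe] using agg_nnnorm_smul_le hD s f m

theorem coeffSMul_add (z : {z : Z // z ≠ 0}) (m m' : M) (x : free Z) :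
    Hom.lin (coeffSMul z (m + m')) x = Hom.lin (coeffSMul z m) x + Hom.lin (coeffSMul z m') x :=
  free_induction (p := fun x => Hom.lin (coeffSMul z (m + m')) x =
      Hom.lin (coeffSMul z m) x + Hom.lin (coeffSMul z m') x)
    (isClosed_eq (continuous_lin _) ((continuous_lin _).add (continuous_lin _)))
    (fun x y hx hy => by simp only [map_add, hx, hy, add_add_add_comm])
    (fun a z' => by simp only [map_smul, coeffSMul_gen, smul_add]) x

theorem coeffSMul_smul (z : {z : Z // z ≠ 0}) (a : A) (m : M) (x : free Z) :
    Hom.lin (coeffSMul z (a • m)) x = a • Hom.lin (coeffSMul z m) x :=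
  free_induction (p := fun x => Hom.lin (coeffSMul z (a • m)) x = a • Hom.lin (coeffSMul z m) x)
    (isClosed_eq (continuous_lin _) ((continuous_lin (coeffSMul z m)).const_smul a))
    (fun x y hx hy => by simp only [map_add, hx, hy, smul_add])
    (fun b z' => by
      rw [map_smul, map_smul, coeffSMul_gen, coeffSMul_gen, smul_comm _ a m, smul_comm b a]) x

/-- The morphism `ℓ(Z, A) ⊗̂ M → M` sending `x ⊗ m` to `x_z m`. -/
noncomputable def tensorCoeff (z : {z : Z // z ≠ 0}) : tensor (free Z) M ⟶ M :=
  tensorLift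
    (LinearMap.mk₂ A (fun x m => Hom.lin (coeffSMul z m) x)
      (fun x y m => map_add _ x y) (fun a x m => map_smul _ a x)
      (fun x m m' => coeffSMul_add z m m' x) (fun a x m => coeffSMul_smul z a m x)) <| by
    obtain ⟨D, hD⟩ := M.bddSMul.exists_bound
    refine ⟨D / ‖z.1‖₊, fun x m => ?_⟩
    have hle : ‖Hom.lin (coeffSMul z m) x‖₊ * ‖z.1‖₊ ≤ D * (‖x‖₊ * ‖m‖₊) := by
      refine le_of_eq_of_le ?_ (agg_nnnorm_coeffSMul_le hD {z} x m)
      cases 𝒞 <;> simp [agg]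
    exact NNReal.coe_le_coe.2 <|
      (le_div_iff₀ (nnnorm_pos.2 z.2)).2 hle |>.trans_eq (mul_div_right_comm _ _ _)

theorem tensorCoeff_tmul (z : {z : Z // z ≠ 0}) (x : free Z) (m : M) :
    Hom.lin (tensorCoeff z) (tmul x m) = Hom.lin (coeffSMul z m) x :=
  tensorLift_tmul ..

theorem exists_agg_tensorCoeff_le (Z M : BanMod 𝒞 A) :
    ∃ D : ℝ≥0, ∀ (s : Finset {z : Z // z ≠ 0}) (t : tensor (free Z) M),
      agg 𝒞 s (fun z => ‖Hom.lin (tensorCoeff z) t‖₊ * ‖z.1‖₊) ≤ D * ‖t‖₊ := by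
  obtain ⟨D, hD⟩ := M.bddSMul.exists_bound
  refine ⟨D, fun s t => tensor_le_of_tmul_le
    (fun t => agg 𝒞 s fun z => ‖Hom.lin (tensorCoeff z) t‖₊ * ‖z.1‖₊)
    (continuous_agg s fun z _ => (continuous_lin _).nnnorm.mul continuous_const)
    (fun n t => ?_) D (fun x m => ?_) t⟩
  · rw [agg_comm]
    refine (agg_le_mul s _ _ 1 fun z _ => ?_).trans_eq (one_mul _)
    rw [one_mul, ← agg_mul, map_sum]
    exact mul_le_mul_left (nnnorm_sum_le_agg _ _) _
  · simp only [tensorCoeff_tmul]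
    exact agg_nnnorm_coeffSMul_le hD s x m

/-- The finite sum `∑ z ⊗ w_z`, where `z` denotes the generator of `ℓ(Z, A)`. -/
noncomputable def genSum (Z M : BanMod 𝒞 A) : ({z : Z // z ≠ 0} →₀ M) →+ tensor (free Z) M :=
  Finsupp.liftAddHom fun z => tmulLeft M (gen z.1)

theorem genSum_single (z : {z : Z // z ≠ 0}) (m : M) :
    genSum Z M (.single z m) = tmul (gen z.1) m :=
  Finsupp.liftAddHom_apply_single ..

theorem genSum_mapRange {N : BanMod 𝒞 A} (f : M ⟶ N) (w : {z : Z // z ≠ 0} →₀ M) :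
    genSum Z N (w.mapRange (Hom.lin f) (map_zero _)) =
      Hom.lin (tensorMap (𝟙 (free Z)) f) (genSum Z M w) := by
  induction w using Finsupp.induction_linear with
  | zero => simp only [Finsupp.mapRange_zero, map_zero]
  | add v w hv hw => rw [Finsupp.mapRange_add (map_add _), map_add, hv, hw, map_add, map_add]
  | single z m =>
    rw [Finsupp.mapRange_single, genSum_single, genSum_single, tensorMap_tmul, lin_id]

theorem tensorCoeff_genSum (z : {z : Z // z ≠ 0}) (w : {z : Z // z ≠ 0} →₀ M) :
    Hom.lin (tensorCoeff z) (genSum Z M w) = w z := by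
  induction w using Finsupp.induction_linear with
  | zero => simp only [map_zero, Finsupp.coe_zero, Pi.zero_apply]
  | add v w hv hw => rw [map_add, map_add, hv, hw, Finsupp.add_apply]
  | single z' m =>
    rw [genSum_single, tensorCoeff_tmul, coeffSMul_gen]
    obtain rfl | hz := eq_or_ne z z'
    · rw [Finsupp.single_eq_same, Finsupp.single_eq_same, one_smul]
    · rw [Finsupp.single_eq_of_ne (Subtype.coe_injective.ne hz), Finsupp.single_eq_of_ne hz,
        zero_smul]

theorem nnnorm_genSum_le (w : {z : Z // z ≠ 0} →₀ M) :
    ‖genSum Z M w‖₊ ≤ ‖(1 : A)‖₊ * agg 𝒞 w.support fun z => ‖w z‖₊ * ‖z.1‖₊ := by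
  refine (nnnorm_sum_le_agg (𝒞 := 𝒞) w.support fun z => tmul (gen z.1) (w z)).trans
    (agg_le_mul _ _ _ _ fun z _ => NNReal.coe_le_coe.1 ?_)
  calc ‖tmul (gen z.1) (w z)‖ ≤ ‖gen z.1‖ * ‖w z‖ := norm_tmul_le _ _
    _ ≤ ‖(1 : A)‖₊ * ‖z.1‖ * ‖w z‖ := by gcongr; exact norm_gen_le z.1
    _ = _ := by push_cast; ring

theorem exists_norm_genSum_le (Z M N : BanMod 𝒞 A) :
    ∃ D : ℝ≥0, ∀ (v : {z : Z // z ≠ 0} →₀ M) (w : {z : Z // z ≠ 0} →₀ N) (C : ℝ≥0),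
      (∀ z, ‖v z‖ ≤ C * ‖w z‖) → ‖genSum Z M v‖ ≤ D * C * ‖genSum Z N w‖ := by
  obtain ⟨D, hD⟩ := exists_agg_tensorCoeff_le Z N
  refine ⟨‖(1 : A)‖₊ * D, fun v w C hvw => ?_⟩
  suffices h : ‖genSum Z M v‖₊ ≤ ‖(1 : A)‖₊ * D * C * ‖genSum Z N w‖₊ by exact_mod_cast h
  calc ‖genSum Z M v‖₊
    _ ≤ ‖(1 : A)‖₊ * agg 𝒞 v.support fun z => ‖v z‖₊ * ‖z.1‖₊ := nnnorm_genSum_le v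
    _ ≤ ‖(1 : A)‖₊ * (C * agg 𝒞 v.support fun z => ‖w z‖₊ * ‖z.1‖₊) := by
      refine mul_le_mul_right (agg_le_mul _ _ _ _ fun z _ => ?_) _
      rw [← mul_assoc]
      exact mul_le_mul_left (show ‖v z‖₊ ≤ C * ‖w z‖₊ from hvw z) _
    _ ≤ ‖(1 : A)‖₊ * (C * (D * ‖genSum Z N w‖₊)) := by
      gcongr
      simpa only [tensorCoeff_genSum] using hD v.support (genSum Z N w)
    _ = _ := by ring

theorem dense_range_genSum (Z M : BanMod 𝒞 A) : Dense (Set.range (genSum Z M)) := by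
  let H : AddSubgroup (tensor (free Z) M) := (genSum Z M).range.topologicalClosure
  have hH : IsClosed (H : Set (tensor (free Z) M)) := AddSubgroup.isClosed_topologicalClosure _
  have hgen (a : A) (z : Z) (m : M) : tmul (a • gen z) m ∈ H := by
    obtain rfl | hz := eq_or_ne z 0
    · rw [gen_zero, smul_zero, zero_tmul]
      exact H.zero_mem
    · rw [smul_tmul, ← genSum_single ⟨z, hz⟩]
      exact AddSubgroup.le_topologicalClosure _ ⟨_, rfl⟩
  have htmul (x : free Z) (m : M) : tmul x m ∈ H :=
    free_induction (p := (tmul · m ∈ H)) (hH.preimage (continuous_tmul_left m))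
      (fun x y hx hy => add_tmul x y m ▸ H.add_mem hx hy) (fun a z => hgen a z m) x
  exact fun t => (tensor_eq_top H hH htmul).ge (AddSubgroup.mem_top t)

theorem StrictlyExactAt.free_tensor {N P : BanMod 𝒞 A} {f : M ⟶ N} {g : N ⟶ P}
    (hfg : StrictlyExactAt f g) (hg : IsStrict g) (Z : BanMod 𝒞 A) :
    StrictlyExactAt (tensorMap (𝟙 (free Z)) f) (tensorMap (𝟙 (free Z)) g) := by
  obtain ⟨C, hC⟩ := hfg.exists_norm_sub_le hg
  choose φ hφ hφf using hC
  have hφ0 : φ 0 = 0 := by simpa using hφ 0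
  obtain ⟨D, hD⟩ := exists_norm_genSum_le Z M N
  obtain ⟨D', hD'⟩ := exists_norm_genSum_le Z N P
  refine strictlyExactAt_of_dense
    (by rw [tensorMap_comp, hfg.comp_eq_zero, tensorMap_zero]) (dense_range_genSum Z N)
    (max (D * C) (D' * C)) (Set.forall_mem_range.2 fun w ε hε => ?_)
  refine ⟨genSum Z M (w.mapRange φ hφ0), ?_, ?_⟩
  · refine (hD _ w C fun z => ?_).trans (le_add_of_le_of_nonneg ?_ hε.le)
    · exact hφ (w z)
    · gcongr
      exact le_max_left (D * C) (D' * C)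
  · rw [← genSum_mapRange, ← genSum_mapRange, ← map_sub]
    refine (hD' _ (w.mapRange (Hom.lin g) (map_zero _)) C fun z => ?_).trans
      (le_add_of_le_of_nonneg ?_ hε.le)
    · exact hφf (w z)
    · gcongr
      exact le_max_right (D * C) (D' * C)

end FreeTensor

/-! ## Tensor products with flat cyclic modules -/

section FlatGenerator

open Filter Topology

variable {𝒞 : Ambient} {A : Type u} [NormedCommRing A]

/-- `e` generates `N` with bounded coefficients, and the annihilator `I` of `e` has a bounded
approximate identity, so that `N ≅ A / I` and `- ⊗̂ N` preserves strict exactness. The approximate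
identity is encoded as `1 - u`, where `u` runs along a filter. -/
structure IsFlatGenerator {N : BanMod 𝒞 A} (e : N) : Prop where
  exists_smul_eq : ∃ C : ℝ≥0, ∀ y : N, ∃ a : A, a • e = y ∧ ‖a‖ ≤ C * ‖y‖
  exists_filter : ∃ (D : ℝ≥0) (l : Filter A), l.NeBot ∧ (∀ᶠ u in l, u • e = e ∧ ‖u‖ ≤ D) ∧
    ∀ i : A, i • e = 0 → Tendsto (fun u => u * i) l (𝓝 0)

variable {M N P Q : BanMod 𝒞 A} {e : N}

theorem tendsto_smul_of_algebraic_tmul_eq_zero (he : ∀ y : N, ∃ a : A, a • e = y) {l : Filter A}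
    (hl : ∀ i : A, i • e = 0 → Tendsto (fun u => u * i) l (𝓝 0)) {x : M}
    (hx : x ⊗ₜ[A] e = 0) : Tendsto (fun u : A => u • x) l (𝓝 0) := by
  obtain ⟨D, hD⟩ := M.bddSMul.exists_bound
  let q : A →ₗ[A] N := LinearMap.toSpanSingleton A N e
  have hx' : q.lTensor M (x ⊗ₜ[A] (1 : A)) = 0 := by
    rw [LinearMap.lTensor_tmul, LinearMap.toSpanSingleton_apply, one_smul, hx]
  obtain ⟨t, ht⟩ := (lTensor_exact M q.exact_subtype_ker_map he _).1 hx'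
  rw [← one_smul A x, ← TensorProduct.rid_tmul, ← ht]
  clear ht
  induction t using TensorProduct.induction_on with
  | zero => simpa only [map_zero, smul_zero] using tendsto_const_nhds
  | add s t hs ht => simpa only [map_add, smul_add, add_zero] using hs.add ht
  | tmul m i =>
    refine squeeze_zero_norm (a := fun u => D * ‖u * i.1‖ * ‖m‖) (fun u => ?_) ?_
    · rw [LinearMap.lTensor_tmul, TensorProduct.rid_tmul, Submodule.subtype_apply, smul_smul]
      exact hD _ _
    · simpa using ((hl i.1 i.2).norm.const_mul (D : ℝ)).mul_const ‖m‖

theorem exists_algebraic_tmul_eq {C : ℝ≥0} (he : ∀ y : N, ∃ a : A, a • e = y ∧ ‖a‖ ≤ C * ‖y‖)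
    (M : BanMod 𝒞 A) :
    ∃ D : ℝ≥0, ∀ (t : PreTensor 𝒞 A M N) (ε : ℝ), 0 < ε →
      ∃ m : M, m ⊗ₜ[A] e = t ∧ ‖m‖ ≤ D * ‖t‖ + ε := by
  obtain ⟨D, hD⟩ := M.bddSMul.exists_bound
  refine ⟨D * C, fun t ε hε => ?_⟩
  obtain ⟨δ, hδ, hδε⟩ := exists_pos_mul_le (D * C) hε
  lift δ to ℝ≥0 using hδ.le
  obtain ⟨r, ⟨n, m, k, rfl, rfl⟩, hr⟩ := PreTensor.exists_size_lt t (e := δ) (mod_cast hδ)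
  choose a ha haC using he
  refine ⟨∑ i, a (k i) • m i, ?_, ?_⟩
  · simp only [TensorProduct.sum_tmul, TensorProduct.smul_tmul, ha]
  · have hterm (i : Fin n) : ‖a (k i) • m i‖₊ ≤ D * C * (‖m i‖₊ * ‖k i‖₊) :=
      calc ‖a (k i) • m i‖₊ ≤ D * ‖a (k i)‖₊ * ‖m i‖₊ := hD _ _
        _ ≤ D * (C * ‖k i‖₊) * ‖m i‖₊ := by gcongr; exact haC _
        _ = _ := by ring
    have hsum := ((nnnorm_sum_le_agg (𝒞 := 𝒞) _ _).trans
      (agg_le_mul _ _ _ _ fun i _ => hterm i)).trans (mul_le_mul_right hr.le _)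
    calc ‖∑ i, a (k i) • m i‖ ≤ (D * C : ℝ≥0) * (_ + δ) := hsum
      _ = (D * C : ℝ≥0) * _ + (D * C : ℝ≥0) * δ := mul_add ..
      _ ≤ _ := by gcongr; rfl

namespace IsFlatGenerator

theorem exists_smul_norm_le (h : IsFlatGenerator e) (M : BanMod 𝒞 A) :
    ∃ C D : ℝ≥0, ∀ (m : M) (ε : ℝ), 0 < ε →
      ∃ u : A, u • e = e ∧ ‖u‖ ≤ D ∧ ‖u • m‖ ≤ C * ‖tmul m e‖ + ε := by
  obtain ⟨C, hC⟩ := h.exists_smul_eq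
  obtain ⟨C', hC'⟩ := exists_algebraic_tmul_eq hC M
  obtain ⟨E, hE⟩ := M.bddSMul.exists_bound
  obtain ⟨D, l, hl, hlD, hl0⟩ := h.exists_filter
  refine ⟨E * D * C', D, fun m ε hε => ?_⟩
  obtain ⟨δ, hδ, hδε⟩ := exists_pos_mul_le (E * D) (half_pos hε)
  obtain ⟨m', hm', hm'C⟩ := hC' (m ⊗ₜ[A] e : M ⊗[A] N) δ hδ
  have hlim : Tendsto (fun u : A => u • (m - m')) l (𝓝 0) :=
    tendsto_smul_of_algebraic_tmul_eq_zero (fun y => (hC y).imp fun _ => And.left) hl0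
      (by rw [TensorProduct.sub_tmul, hm', sub_self])
  have hlim' : ∀ᶠ u : A in l, ‖u • (m - m')‖ ≤ ε / 2 :=
    hlim.norm.eventually_le_const (by simpa only [norm_zero] using half_pos hε)
  obtain ⟨u, ⟨hue, huD⟩, hu⟩ := (hlD.and hlim').exists
  refine ⟨u, hue, huD, ?_⟩
  have hm'_le : ‖m'‖ ≤ C' * ‖tmul m e‖ + δ :=
    hm'C.trans_eq (congrArg (C' * · + δ) (norm_toComplete (𝒞 := 𝒞) (A := A) _).symm)
  calc ‖u • m‖ = ‖u • m' + u • (m - m')‖ := by rw [← smul_add, add_sub_cancel]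
    _ ≤ E * D * (C' * ‖tmul m e‖ + δ) + ε / 2 := by
      refine (norm_add_le _ _).trans (add_le_add ((hE _ _).trans ?_) hu)
      gcongr
    _ = E * D * C' * ‖tmul m e‖ + ((E * D : ℝ≥0) * δ + ε / 2) := by push_cast; ring
    _ ≤ E * D * C' * ‖tmul m e‖ + ε := by linarith

theorem exists_tmul_eq_norm_le (h : IsFlatGenerator e) (f : M ⟶ P) :
    ∃ C : ℝ≥0, ∀ (m : M) (ε : ℝ), 0 < ε → ∃ m' : M, tmul m' e = tmul m e ∧
      ‖m'‖ ≤ C * ‖tmul m e‖ + ε ∧ ‖Hom.lin f m'‖ ≤ C * ‖tmul (Hom.lin f m) e‖ + ε := by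
  obtain ⟨C₁, D, hM⟩ := h.exists_smul_norm_le M
  obtain ⟨C₂, _, hP⟩ := h.exists_smul_norm_le P
  obtain ⟨E, hE⟩ := P.bddSMul.exists_bound
  refine ⟨max C₁ (E * D * C₂), fun m ε hε => ?_⟩
  obtain ⟨δ, hδ, hδε⟩ := exists_pos_mul_le (E * D) hε
  obtain ⟨u, hue, -, hu⟩ := hP (Hom.lin f m) δ hδ
  obtain ⟨v, hve, hvD, hv⟩ := hM (u • m) ε hε
  have htmul : tmul (u • m) e = tmul m e := by rw [smul_tmul, hue]
  refine ⟨v • u • m, by rw [smul_tmul, hve, htmul], ?_, ?_⟩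
  · rw [htmul] at hv
    exact hv.trans (by gcongr; exact le_max_left _ _)
  · rw [map_smul, map_smul]
    calc ‖v • u • Hom.lin f m‖ ≤ E * D * (C₂ * ‖tmul (Hom.lin f m) e‖ + δ) :=
          (hE _ _).trans (by gcongr)
      _ = (E * D * C₂ : ℝ≥0) * ‖tmul (Hom.lin f m) e‖ + (E * D : ℝ≥0) * δ := by push_cast; ring
      _ ≤ _ := by gcongr; exact le_max_right _ _

theorem dense_range_tmulRight (h : IsFlatGenerator e) (M : BanMod 𝒞 A) :
    Dense (Set.range (tmulRight M e)) := by
  obtain ⟨C, hC⟩ := h.exists_smul_eq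
  let H : AddSubgroup (tensor M N) := (tmulRight M e).range.topologicalClosure
  have htmul (x : M) (y : N) : tmul x y ∈ H := by
    obtain ⟨a, rfl, -⟩ := hC y
    exact AddSubgroup.le_topologicalClosure _ ⟨a • x, smul_tmul a x e⟩
  exact fun t => (tensor_eq_top H (AddSubgroup.isClosed_topologicalClosure _) htmul).ge
    (AddSubgroup.mem_top t)

theorem strictlyExactAt_of_exists_tmul_eq (h : IsFlatGenerator e) {R : BanMod 𝒞 A} {f : M ⟶ P}
    {g : P ⟶ Q} (hfg : StrictlyExactAt f g) (hg : IsStrict g) {G : tensor P N ⟶ R}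
    (h0 : tensorMap f (𝟙 N) ≫ G = 0) (C : ℝ≥0)
    (hG : ∀ (p : P) (ε : ℝ), 0 < ε → ∃ p' : P, tmul p' e = tmul p e ∧
      ‖p'‖ ≤ C * ‖tmul p e‖ + ε ∧ ‖Hom.lin g p'‖ ≤ C * ‖Hom.lin G (tmul p e)‖ + ε) :
    StrictlyExactAt (tensorMap f (𝟙 N)) G := by
  obtain ⟨C', hC'⟩ := hfg.exists_norm_sub_le hg
  refine strictlyExactAt_of_dense h0 (h.dense_range_tmulRight P) (C' * ‖e‖₊ * C)
    (Set.forall_mem_range.2 fun p ε hε => ?_)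
  obtain ⟨δ, hδ, hδε⟩ := exists_pos_mul_le (C' * ‖e‖₊) hε
  obtain ⟨p', hp', hp'C, hgp'⟩ := hG p δ hδ
  obtain ⟨x, hx, hxp'⟩ := hC' p'
  have hbound {E : BanMod 𝒞 A} {z : E} {r s : ℝ} (hz : ‖z‖ ≤ C' * s) (hs : s ≤ C * r + δ) :
      ‖tmul z e‖ ≤ (C' * ‖e‖₊ * C : ℝ≥0) * r + ε :=
    calc ‖tmul z e‖ ≤ C' * (C * r + δ) * ‖e‖ := (norm_tmul_le _ _).trans (by gcongr; grw [hz, hs])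
      _ = (C' * ‖e‖₊ * C : ℝ≥0) * r + (C' * ‖e‖₊ : ℝ≥0) * δ := by push_cast; ring
      _ ≤ _ := by gcongr
  have hsub : tmul p e - Hom.lin (tensorMap f (𝟙 N)) (tmul x e) = tmul (p' - Hom.lin f x) e := by
    rw [tensorMap_tmul, lin_id, sub_tmul, hp']
  exact ⟨tmul x e, hbound hx hp'C, (congrArg norm hsub).trans_le (hbound hxp' hgp')⟩

theorem strictlyExactAt_tensorMap (h : IsFlatGenerator e) {f : M ⟶ P} {g : P ⟶ Q}
    (hfg : StrictlyExactAt f g) (hg : IsStrict g) :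
    StrictlyExactAt (tensorMap f (𝟙 N)) (tensorMap g (𝟙 N)) := by
  obtain ⟨C, hC⟩ := h.exists_tmul_eq_norm_le g
  refine h.strictlyExactAt_of_exists_tmul_eq hfg hg
    (by rw [tensorMap_comp, hfg.comp_eq_zero, zero_tensorMap]) C fun p ε hε => ?_
  simpa only [tensorMap_tmul, lin_id] using hC p ε hε

theorem strictlyExactAt_tensorMap_of_tmul (h : IsFlatGenerator e) {f : M ⟶ P} {g : P ⟶ Q}
    (hfg : StrictlyExactAt f g) (hg : IsStrict g) {μ : tensor P N ⟶ Q}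
    (hμ : ∀ p, Hom.lin μ (tmul p e) = Hom.lin g p) : StrictlyExactAt (tensorMap f (𝟙 N)) μ := by
  obtain ⟨C, hC⟩ := h.exists_tmul_eq_norm_le (𝟙 P)
  have h0 : tensorMap f (𝟙 N) ≫ μ = 0 := tensor_hom_ext fun x y => by
    obtain ⟨E, hE⟩ := h.exists_smul_eq
    obtain ⟨a, rfl, -⟩ := hE y
    rw [lin_comp, tensorMap_tmul, lin_id, ← smul_tmul, hμ, ← map_smul,
      lin_lin_eq_zero hfg.comp_eq_zero, lin_zero]
  refine h.strictlyExactAt_of_exists_tmul_eq hfg hg h0 (max C 1) fun p ε hε => ?_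
  obtain ⟨p', hp', hp'C, -⟩ := hC p ε hε
  refine ⟨p', hp', hp'C.trans (by gcongr; exact le_max_left _ _), ?_⟩
  rw [← hμ, hp']
  exact le_add_of_le_of_nonneg
    (le_mul_of_one_le_left (norm_nonneg _) (mod_cast le_max_right _ _)) hε.le

end IsFlatGenerator

end FlatGenerator

/-! ## Total complexes -/

section Total

variable {𝒞 : Ambient} {A : Type u} [NormedCommRing A]

/-- Evaluation of morphisms at `x`, as an additive homomorphism. -/
def evalHom {M : BanMod 𝒞 A} (N : BanMod 𝒞 A) (x : M) : (M ⟶ N) →+ N :=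
  AddMonoidHom.mk' (Hom.lin · x) fun f g => lin_add f g x

theorem lin_units_smul {M N : BanMod 𝒞 A} (ε : ℤˣ) (f : M ⟶ N) (x : M) :
    Hom.lin (ε • f) x = ε • Hom.lin f x :=
  map_zsmul_unit (evalHom N x) ε f

theorem lin_sum {ι : Type*} {M N : BanMod 𝒞 A} (s : Finset ι) (f : ι → (M ⟶ N)) (x : M) :
    Hom.lin (∑ i ∈ s, f i) x = ∑ i ∈ s, Hom.lin (f i) x :=
  map_sum (evalHom N x) f s

theorem HasBddLifts.of_sub_mem {M N : BanMod 𝒞 A} {f : M ⟶ N} {s t : Set N}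
    (ht : HasBddLifts f t)
    (hst : ∃ C : ℝ≥0, ∀ y ∈ s, ∃ z, y - Hom.lin f z ∈ t ∧ ‖z‖ ≤ C * ‖y‖) : HasBddLifts f s := by
  obtain ⟨C, hC⟩ := ht
  obtain ⟨C', hC'⟩ := hst
  obtain ⟨L, hL⟩ := Hom.isBdd f
  refine ⟨C * (1 + L * C') + C', fun y hy => ?_⟩
  obtain ⟨z, hz, hzy⟩ := hC' y hy
  obtain ⟨w, hw, hwy⟩ := hC _ hz
  refine ⟨w + z, by rw [map_add, hw, sub_add_cancel], ?_⟩
  calc ‖w + z‖ ≤ C * (‖y‖ + L * (C' * ‖y‖)) + C' * ‖y‖ := by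
        refine norm_add_le_of_le (hwy.trans ?_) hzy
        gcongr
        exact norm_sub_le_of_le le_rfl ((hL z).trans (by gcongr))
    _ = _ := by push_cast; ring

variable (K L : ChainComplex (BanMod 𝒞 A) ℕ)

/-- The total complex `Tot (K ⊗̂ L)`. -/
noncomputable abbrev tot : ChainComplex (BanMod 𝒞 A) ℕ :=
  HomologicalComplex.mapBifunctor K L (tensorFunctor 𝒞 A) (ComplexShape.down ℕ)

/-- The inclusion of a summand of the total complex. -/
noncomputable def totι (i j n : ℕ) (h : i + j = n) : tensor (K.X i) (L.X j) ⟶ (tot K L).X n :=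
  HomologicalComplex.ιMapBifunctor K L (tensorFunctor 𝒞 A) (ComplexShape.down ℕ) i j n h

/-- The projection to a summand of the total complex. -/
noncomputable def totπ (i j n : ℕ) (h : i + j = n) : (tot K L).X n ⟶ tensor (K.X i) (L.X j) :=
  HomologicalComplex.mapBifunctorDesc fun i' j' h' =>
    if hi : i' = i then eqToHom (by
      have h' : i' + j' = n := h'
      obtain rfl := hi
      obtain rfl : j' = j := by omega
      rfl) else 0

/-- The first differential of the double complex, as a map to the total complex. -/
noncomputable def totD₁ (i j n : ℕ) : tensor (K.X i) (L.X j) ⟶ (tot K L).X n :=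
  HomologicalComplex.mapBifunctor.d₁ K L (tensorFunctor 𝒞 A) (ComplexShape.down ℕ) i j n

/-- The second differential of the double complex, with its sign, as a map to the total complex. -/
noncomputable def totD₂ (i j n : ℕ) : tensor (K.X i) (L.X j) ⟶ (tot K L).X n :=
  HomologicalComplex.mapBifunctor.d₂ K L (tensorFunctor 𝒞 A) (ComplexShape.down ℕ) i j n

variable {K L}

theorem tot_hom_ext {n : ℕ} {M : BanMod 𝒞 A} {f g : (tot K L).X n ⟶ M}
    (h : ∀ i j h, totι K L i j n h ≫ f = totι K L i j n h ≫ g) : f = g :=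
  HomologicalComplex.mapBifunctor.hom_ext h

theorem totι_totπ (i j n : ℕ) (h : i + j = n) : totι K L i j n h ≫ totπ K L i j n h = 𝟙 _ :=
  (HomologicalComplex.ι_mapBifunctorDesc _ i j h).trans (dif_pos rfl)

theorem totι_totπ_of_ne {i j i' j' n : ℕ} (h : i + j = n) (h' : i' + j' = n) (hi : i ≠ i') :
    totι K L i j n h ≫ totπ K L i' j' n h' = 0 :=
  (HomologicalComplex.ι_mapBifunctorDesc _ i j h).trans (dif_neg hi)

theorem lin_totπ_totι (i j n : ℕ) (h : i + j = n) (x : tensor (K.X i) (L.X j)) :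
    Hom.lin (totπ K L i j n h) (Hom.lin (totι K L i j n h) x) = x := by
  rw [← lin_comp, totι_totπ, lin_id]

theorem lin_totπ_totι_of_ne {i j i' j' n : ℕ} (h : i + j = n) (h' : i' + j' = n) (hi : i ≠ i')
    (x : tensor (K.X i) (L.X j)) :
    Hom.lin (totπ K L i' j' n h') (Hom.lin (totι K L i j n h) x) = 0 :=
  lin_lin_eq_zero (totι_totπ_of_ne h h' hi) x

theorem sum_totπ_totι (n : ℕ) :
    ∑ i : Fin (n + 1), totπ K L i (n - i) n (by omega) ≫ totι K L i (n - i) n (by omega) = 𝟙 _ := by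
  refine tot_hom_ext fun i j h => ?_
  rw [Preadditive.comp_sum, Finset.sum_eq_single (⟨i, by omega⟩ : Fin (n + 1))]
  · obtain rfl : j = n - i := by omega
    rw [← Category.assoc, totι_totπ, Category.id_comp, Category.comp_id]
  · intro i' _ hi'
    rw [← Category.assoc, totι_totπ_of_ne _ _ fun hi => hi' (Fin.ext hi.symm), zero_comp]
  · exact fun hi => absurd (Finset.mem_univ _) hi

theorem eq_zero_of_totπ {n : ℕ} (y : (tot K L).X n)
    (h : ∀ i j h, Hom.lin (totπ K L i j n h) y = 0) : y = 0 := by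
  rw [← lin_id _ y, ← sum_totπ_totι, lin_sum]
  refine Finset.sum_eq_zero fun i _ => ?_
  rw [lin_comp, h, map_zero]

theorem totι_d (i j n : ℕ) (h : i + j = n + 1) :
    totι K L i j (n + 1) h ≫ (tot K L).d (n + 1) n = totD₁ K L i j n + totD₂ K L i j n := by
  change HomologicalComplex.ιMapBifunctor _ _ _ _ i j (n + 1) h ≫
    (HomologicalComplex.mapBifunctor.D₁ _ _ _ _ (n + 1) n +
      HomologicalComplex.mapBifunctor.D₂ _ _ _ _ (n + 1) n) = _
  rw [Preadditive.comp_add, HomologicalComplex.mapBifunctor.ι_D₁,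
    HomologicalComplex.mapBifunctor.ι_D₂]
  rfl

theorem totD₁_zero (j n : ℕ) : totD₁ K L 0 j n = 0 :=
  HomologicalComplex.mapBifunctor.d₁_eq_zero _ _ _ _ 0 j n (by simp)

theorem totD₁_succ (i j n : ℕ) (h : i + j = n) :
    totD₁ K L (i + 1) j n = tensorMap (K.d (i + 1) i) (𝟙 _) ≫ totι K L i j n h :=
  (HomologicalComplex.mapBifunctor.d₁_eq _ _ _ _ (ComplexShape.down_mk _ _ rfl) j n h).trans
    (one_smul ℤˣ _)

theorem totD₂_zero (i n : ℕ) : totD₂ K L i 0 n = 0 :=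
  HomologicalComplex.mapBifunctor.d₂_eq_zero _ _ _ _ i 0 n (by simp)

theorem totD₂_succ (i j n : ℕ) (h : i + j = n) :
    totD₂ K L i (j + 1) n =
      (-1 : ℤˣ) ^ i • (tensorMap (𝟙 _) (L.d (j + 1) j) ≫ totι K L i j n h) :=
  HomologicalComplex.mapBifunctor.d₂_eq _ _ _ _ i (ComplexShape.down_mk _ _ rfl) n h

theorem totD₁_totπ {i j n : ℕ} (h : i + j = n) {i' j' : ℕ} (h' : i' + j' = n + 1) :
    totD₁ K L i' j' n ≫ totπ K L i j n h =
      totι K L i' j' (n + 1) h' ≫ totπ K L (i + 1) j (n + 1) (by omega) ≫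
        tensorMap (K.d (i + 1) i) (𝟙 _) := by
  obtain _ | i' := i'
  · rw [totD₁_zero, zero_comp, ← Category.assoc, totι_totπ_of_ne _ _ (by omega), zero_comp]
  rw [totD₁_succ i' j' n (by omega), Category.assoc, ← Category.assoc (totι _ _ _ _ _ _)]
  obtain rfl | hne := eq_or_ne i' i
  · obtain rfl : j' = j := by omega
    rw [totι_totπ, totι_totπ, Category.comp_id, Category.id_comp]
  · rw [totι_totπ_of_ne _ _ hne, totι_totπ_of_ne _ _ (by omega), comp_zero, zero_comp]

theorem totD₂_totπ {i j n : ℕ} (h : i + j = n) {i' j' : ℕ} (h' : i' + j' = n + 1) :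
    totD₂ K L i' j' n ≫ totπ K L i j n h =
      totι K L i' j' (n + 1) h' ≫ ((-1 : ℤˣ) ^ i •
        (totπ K L i (j + 1) (n + 1) (by omega) ≫ tensorMap (𝟙 _) (L.d (j + 1) j))) := by
  rw [Linear.comp_units_smul]
  obtain _ | j' := j'
  · rw [totD₂_zero, zero_comp, ← Category.assoc, totι_totπ_of_ne _ _ (by omega), zero_comp,
      smul_zero]
  rw [totD₂_succ i' j' n (by omega), Linear.units_smul_comp, Category.assoc,
    ← Category.assoc (totι _ _ _ _ _ _)]
  obtain rfl | hne := eq_or_ne i' i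
  · obtain rfl : j' = j := by omega
    rw [totι_totπ, totι_totπ, Category.comp_id, Category.id_comp]
  · rw [totι_totπ_of_ne _ _ hne, totι_totπ_of_ne _ _ hne, comp_zero, zero_comp, smul_zero,
      smul_zero]

theorem tot_d_totπ {i j n : ℕ} (h : i + j = n) :
    (tot K L).d (n + 1) n ≫ totπ K L i j n h =
      totπ K L (i + 1) j (n + 1) (by omega) ≫ tensorMap (K.d (i + 1) i) (𝟙 _) +
      (-1 : ℤˣ) ^ i •
        (totπ K L i (j + 1) (n + 1) (by omega) ≫ tensorMap (𝟙 _) (L.d (j + 1) j)) :=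
  tot_hom_ext fun i' j' h' => by
    rw [← Category.assoc, totι_d, Preadditive.add_comp, Preadditive.comp_add, totD₁_totπ h h',
      totD₂_totπ h h']

theorem lin_totπ_d {i j n : ℕ} (h : i + j = n) (y : (tot K L).X (n + 1)) :
    Hom.lin (totπ K L i j n h) (Hom.lin ((tot K L).d (n + 1) n) y) =
      Hom.lin (tensorMap (K.d (i + 1) i) (𝟙 _))
        (Hom.lin (totπ K L (i + 1) j (n + 1) (by omega)) y) +
      (-1 : ℤˣ) ^ i • Hom.lin (tensorMap (𝟙 _) (L.d (j + 1) j))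
        (Hom.lin (totπ K L i (j + 1) (n + 1) (by omega)) y) := by
  rw [← lin_comp, tot_d_totπ, lin_add, lin_comp, lin_units_smul, lin_comp]

/-- The columns `K_i ⊗̂ L → K_i ⊗̂ N → 0` of the double complex, augmented by `η : L₀ → N`, are
strictly exact. -/
structure ColumnsExact (K L : ChainComplex (BanMod 𝒞 A) ℕ) {N : BanMod 𝒞 A} (η : L.X 0 ⟶ N) :
    Prop where
  succ : ∀ i j, StrictlyExactAt (tensorMap (𝟙 (K.X i)) (L.d (j + 2) (j + 1)))
    (tensorMap (𝟙 (K.X i)) (L.d (j + 1) j))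
  zero : ∀ i, StrictlyExactAt (tensorMap (𝟙 (K.X i)) (L.d 1 0)) (tensorMap (𝟙 (K.X i)) η)
  surj : ∀ i, HasBddLifts (tensorMap (𝟙 (K.X i)) η) Set.univ

variable {N : BanMod 𝒞 A} {η : L.X 0 ⟶ N}

/-- The morphism `Tot (K ⊗̂ L)_n → K_n ⊗̂ N` induced by `η`, which vanishes on the summands other
than `K_n ⊗̂ L₀`. -/
noncomputable def totAug (K : ChainComplex (BanMod 𝒞 A) ℕ) (η : L.X 0 ⟶ N) (n : ℕ) :
    (tot K L).X n ⟶ tensor (K.X n) N :=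
  totπ K L n 0 n rfl ≫ tensorMap (𝟙 (K.X n)) η

theorem lin_totAug (n : ℕ) (y : (tot K L).X n) :
    Hom.lin (totAug K η n) y =
      Hom.lin (tensorMap (𝟙 (K.X n)) η) (Hom.lin (totπ K L n 0 n rfl) y) :=
  lin_comp _ _ y

/-- The cycles of degree `n` of the total complex which are supported in the columns `i < k` and
killed by `η`: the filtration by columns along which cycles are lifted. -/
def columnCycles (K : ChainComplex (BanMod 𝒞 A) ℕ) (η : L.X 0 ⟶ N) (n k : ℕ) :
    Set ((tot K L).X n) :=
  {y | (∀ m, Hom.lin ((tot K L).d n m) y = 0) ∧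
    (∀ i j h, k ≤ i → Hom.lin (totπ K L i j n h) y = 0) ∧ Hom.lin (totAug K η n) y = 0}

theorem ColumnsExact.tot_d_totAug (hc : ColumnsExact K L η) (n : ℕ) :
    (tot K L).d (n + 1) n ≫ totAug K η n =
      totAug K η (n + 1) ≫ tensorMap (K.d (n + 1) n) (𝟙 N) := by
  have hη : tensorMap (𝟙 (K.X n)) (L.d (0 + 1) 0) ≫ tensorMap (𝟙 (K.X n)) η = 0 :=
    (hc.zero n).comp_eq_zero
  rw [totAug, totAug, ← Category.assoc, tot_d_totπ (add_zero n), Preadditive.add_comp,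
    Linear.units_smul_comp, Category.assoc, Category.assoc, Category.assoc, hη, comp_zero,
    smul_zero, add_zero, tensorMap_comp, tensorMap_comp, Category.comp_id, Category.id_comp,
    Category.comp_id, Category.id_comp]

theorem ColumnsExact.hasBddLifts_column (hc : ColumnsExact K L η) (k j : ℕ) :
    HasBddLifts (tensorMap (𝟙 (K.X k)) (L.d (j + 1) j))
      (Hom.lin (totπ K L k j (k + j) rfl) '' columnCycles K η (k + j) (k + 1)) := by
  obtain _ | j := j
  · refine (hc.zero k).hasBddLifts.mono ?_
    rintro _ ⟨y, ⟨-, -, hy⟩, rfl⟩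
    rwa [lin_totAug] at hy
  · refine (hc.succ k j).hasBddLifts.mono ?_
    rintro _ ⟨y, ⟨hy, hcol, -⟩, rfl⟩
    have hd := lin_totπ_d (K := K) (L := L) (i := k) (j := j) rfl y
    have hy' : Hom.lin ((tot K L).d (k + j + 1) (k + j)) y = 0 := hy _
    have hcol' : Hom.lin (totπ K L (k + 1) j (k + j + 1) (by omega)) y = 0 :=
      hcol _ _ _ le_rfl
    rw [hy', map_zero, hcol', map_zero, zero_add] at hd
    exact (smul_eq_zero_iff_eq _).1 hd.symm

theorem ColumnsExact.sub_mem_columnCycles (hc : ColumnsExact K L η) {k j : ℕ}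
    {y : (tot K L).X (k + j)} (hy : y ∈ columnCycles K η (k + j) (k + 1))
    {x : tensor (K.X k) (L.X (j + 1))}
    (hx : Hom.lin (tensorMap (𝟙 (K.X k)) (L.d (j + 1) j)) x =
      Hom.lin (totπ K L k j (k + j) rfl) y) :
    y - Hom.lin ((tot K L).d (k + j + 1) (k + j))
      (Hom.lin (totι K L k (j + 1) (k + j + 1) rfl) ((-1 : ℤˣ) ^ k • x)) ∈
      columnCycles K η (k + j) k := by
  set z := Hom.lin (totι K L k (j + 1) (k + j + 1) rfl) ((-1 : ℤˣ) ^ k • x) with hz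
  obtain ⟨hcycle, hcol, haug⟩ := hy
  refine ⟨fun m => ?_, fun i j' h hi => ?_, ?_⟩
  · rw [map_sub, hcycle, lin_lin_eq_zero (HomologicalComplex.d_comp_d _ _ _ _), sub_zero]
  · have hz₁ : Hom.lin (totπ K L (i + 1) j' (k + j + 1) (by omega)) z = 0 :=
      lin_totπ_totι_of_ne _ _ (by omega) _
    rw [map_sub, lin_totπ_d h, hz₁, map_zero, zero_add]
    obtain rfl | hlt := eq_or_lt_of_le hi
    · obtain rfl : j' = j := by omega
      rw [hz, lin_totπ_totι, map_zsmul_unit, smul_smul, Int.units_mul_self, one_smul, hx, sub_self]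
    · rw [hcol i j' h hlt, hz, lin_totπ_totι_of_ne _ _ hlt.ne, map_zero, smul_zero, sub_zero]
  · have hz₀ : Hom.lin (totπ K L (k + j + 1) 0 (k + j + 1) rfl) z = 0 :=
      lin_totπ_totι_of_ne _ _ (by omega) _
    rw [map_sub, haug, ← lin_comp, hc.tot_d_totAug, lin_comp, lin_totAug, hz₀, map_zero,
      map_zero, sub_zero]

theorem ColumnsExact.hasBddLifts_columnCycles (hc : ColumnsExact K L η) (n k : ℕ)
    (hk : k ≤ n + 1) : HasBddLifts ((tot K L).d (n + 1) n) (columnCycles K η n k) := by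
  induction k with
  | zero =>
    refine ⟨0, fun y hy => ⟨0, ?_, by simp⟩⟩
    rw [map_zero, eq_zero_of_totπ y fun i j h => hy.2.1 i j h i.zero_le]
  | succ k ih =>
    obtain ⟨j, rfl⟩ := Nat.exists_eq_add_of_le (Nat.le_of_succ_le_succ hk)
    refine (ih (by omega)).of_sub_mem ?_
    obtain ⟨C, hC⟩ := hc.hasBddLifts_column k j
    obtain ⟨D, hD⟩ := Hom.isBdd (totπ K L k j (k + j) rfl)
    obtain ⟨E, hE⟩ := Hom.isBdd (totι K L k (j + 1) (k + j + 1) rfl)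
    refine ⟨E * (C * D), fun y hy => ?_⟩
    obtain ⟨x, hx, hxC⟩ := hC _ ⟨y, hy, rfl⟩
    refine ⟨_, hc.sub_mem_columnCycles hy hx, ?_⟩
    calc _ ≤ E * ‖(-1 : ℤˣ) ^ k • x‖ := hE _
      _ ≤ E * (C * (D * ‖y‖)) := by
        rw [norm_units_zsmul]
        gcongr
        exact hxC.trans (by gcongr; exact hD y)
      _ = _ := by push_cast; ring

theorem ColumnsExact.hasBddLifts_tot (hc : ColumnsExact K L η) {n : ℕ} {t : Set (tensor (K.X n) N)}
    (ht : HasBddLifts (tensorMap (K.d (n + 1) n) (𝟙 N)) t) :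
    HasBddLifts ((tot K L).d (n + 1) n)
      {y | (∀ m, Hom.lin ((tot K L).d n m) y = 0) ∧ Hom.lin (totAug K η n) y ∈ t} := by
  refine (hc.hasBddLifts_columnCycles n (n + 1) le_rfl).of_sub_mem ?_
  obtain ⟨C, hC⟩ := ht
  obtain ⟨D, hD⟩ := hc.surj (n + 1)
  obtain ⟨E, hE⟩ := Hom.isBdd (totAug K η n)
  obtain ⟨F, hF⟩ := Hom.isBdd (totι K L (n + 1) 0 (n + 1) rfl)
  refine ⟨F * (D * (C * E)), fun y ⟨hy, hyt⟩ => ?_⟩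
  obtain ⟨p, hp, hpC⟩ := hC _ hyt
  obtain ⟨x, hx, hxD⟩ := hD p (Set.mem_univ _)
  refine ⟨Hom.lin (totι K L (n + 1) 0 (n + 1) rfl) x, ⟨fun m => ?_, fun i j h hi => ?_, ?_⟩, ?_⟩
  · rw [map_sub, hy, lin_lin_eq_zero (HomologicalComplex.d_comp_d _ _ _ _), sub_zero]
  · omega
  · rw [map_sub, ← lin_comp, hc.tot_d_totAug, lin_comp, lin_totAug (n + 1), lin_totπ_totι, hx,
      hp, sub_self]
  · calc _ ≤ F * ‖x‖ := hF x
      _ ≤ F * (D * (C * (E * ‖y‖))) := by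
        gcongr
        exact hxD.trans (by gcongr; exact hpC.trans (by gcongr; exact hE y))
      _ = _ := by push_cast; ring

theorem ColumnsExact.strictlyExactAt_tot_succ (hc : ColumnsExact K L η) (n : ℕ)
    (hr : StrictlyExactAt (tensorMap (K.d (n + 2) (n + 1)) (𝟙 N))
      (tensorMap (K.d (n + 1) n) (𝟙 N))) :
    StrictlyExactAt ((tot K L).d (n + 2) (n + 1)) ((tot K L).d (n + 1) n) := by
  refine strictlyExactAt_iff.2 ⟨HomologicalComplex.d_comp_d _ _ _ _,
    (hc.hasBddLifts_tot hr.hasBddLifts).mono fun y hy => ⟨fun m => ?_, ?_⟩⟩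
  · obtain rfl | hm := eq_or_ne m n
    · exact hy
    · rw [(tot K L).shape _ _ fun h => hm (Nat.succ_injective h), lin_zero]
  · rw [Set.mem_ofPred, ← lin_comp, ← hc.tot_d_totAug, lin_comp, hy, map_zero]

theorem ColumnsExact.strictlyExactAt_tot_zero (hc : ColumnsExact K L η) {Q : BanMod 𝒞 A}
    {μ : tensor (K.X 0) N ⟶ Q} (hr : StrictlyExactAt (tensorMap (K.d 1 0) (𝟙 N)) μ) :
    StrictlyExactAt ((tot K L).d 1 0) (totAug K η 0 ≫ μ) := by
  refine strictlyExactAt_iff.2 ⟨?_,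
    (hc.hasBddLifts_tot hr.hasBddLifts).mono fun y hy => ⟨fun m => ?_, ?_⟩⟩
  · rw [← Category.assoc, hc.tot_d_totAug, Category.assoc, hr.comp_eq_zero, comp_zero]
  · rw [(tot K L).shape _ _ m.succ_ne_zero, lin_zero]
  · rwa [Set.mem_ofPred, ← lin_comp]

end Total

end BanMod

/-! ## Quasi-isomorphisms -/

section QuasiIso

variable {𝒞 : Ambient} {A : Type u} [NormedCommRing A]

namespace BanMod

variable {M N P M' N' P' : BanMod 𝒞 A}

theorem eq_of_isZero (h : IsZero M) (x y : M) : x = y := by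
  rw [← lin_id M x, ← lin_id M y, (IsZero.iff_id_eq_zero M).1 h, lin_zero, lin_zero]

theorem lin_inv_lin_hom (α : M ≅ N) (x : M) : Hom.lin α.inv (Hom.lin α.hom x) = x := by
  rw [← lin_comp, α.hom_inv_id, lin_id]

theorem lin_hom_lin_inv (α : M ≅ N) (x : N) : Hom.lin α.hom (Hom.lin α.inv x) = x := by
  rw [← lin_comp, α.inv_hom_id, lin_id]

theorem lin_neg (f : M ⟶ N) (x : M) : Hom.lin (-f) x = -Hom.lin f x :=
  map_neg (evalHom N x) f

theorem lin_sub (f g : M ⟶ N) (x : M) : Hom.lin (f - g) x = Hom.lin f x - Hom.lin g x :=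
  map_sub (evalHom N x) f g

theorem HasBddLifts.of_iso {f : M ⟶ N} {s : Set N} (h : HasBddLifts f s) (α : M' ≅ M)
    (β : N' ≅ N) : HasBddLifts (α.hom ≫ f ≫ β.inv) (Hom.lin β.hom ⁻¹' s) := by
  obtain ⟨C, hC⟩ := h
  obtain ⟨D, hD⟩ := Hom.isBdd α.inv
  obtain ⟨E, hE⟩ := Hom.isBdd β.hom
  refine ⟨D * C * E, fun y hy => ?_⟩
  obtain ⟨x, hx, hxy⟩ := hC _ hy
  refine ⟨Hom.lin α.inv x, ?_, ?_⟩
  · rw [lin_comp, lin_comp, lin_hom_lin_inv, hx, lin_inv_lin_hom]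
  · calc _ ≤ D * ‖x‖ := hD x
      _ ≤ D * (C * (E * ‖y‖)) := by gcongr; exact hxy.trans (by gcongr; exact hE y)
      _ = _ := by push_cast; ring

theorem StrictlyExactAt.of_iso {f : M ⟶ N} {g : N ⟶ P} (h : StrictlyExactAt f g) (α : M' ≅ M)
    (β : N' ≅ N) (γ : P' ≅ P) :
    StrictlyExactAt (α.hom ≫ f ≫ β.inv) (β.hom ≫ g ≫ γ.inv) := by
  refine strictlyExactAt_iff.2 ⟨?_, (h.hasBddLifts.of_iso α β).mono fun y hy => ?_⟩
  · simp only [Category.assoc, Iso.inv_hom_id_assoc]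
    rw [← Category.assoc f, h.comp_eq_zero, zero_comp, comp_zero]
  · rw [Set.mem_ofPred, lin_comp, lin_comp] at hy
    change Hom.lin g _ = 0
    rw [← lin_hom_lin_inv γ (Hom.lin g _), hy, map_zero]

end BanMod

open BanMod CochainComplex

section Cone

variable {F G : CochainComplex (BanMod 𝒞 A) ℤ} {φ : F ⟶ G} {i j k l : ℤ}

theorem lin_fst_mem_of_mappingCone_cycle (hG : G.d j k = 0) (hjk : j + 1 = k) (hkl : k + 1 = l)
    {y : (mappingCone φ).X j} (hy : Hom.lin ((mappingCone φ).d j k) y = 0) :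
    Hom.lin ((mappingCone.fst φ).1.v j k hjk) y ∈
      {a | Hom.lin (F.d k l) a = 0 ∧ Hom.lin (φ.f k) a = 0} := by
  have h_snd := mappingCone.d_snd_v φ j k hjk
  rw [hG, comp_zero, add_zero] at h_snd
  constructor
  · rw [← lin_comp, ← neg_eq_zero, ← lin_neg, ← mappingCone.d_fst_v φ j k l hjk hkl, lin_comp,
      hy, map_zero]
  · rw [← lin_comp, ← h_snd, lin_comp, hy, map_zero]

theorem mappingCone_d_inl_eq (hij : i + 1 = j) (hjk : j + 1 = k) {y : (mappingCone φ).X j}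
    {x : F.X j} (hx : Hom.lin (F.d j k) x = -Hom.lin ((mappingCone.fst φ).1.v j k hjk) y)
    (hφx : Hom.lin (φ.f j) x = Hom.lin ((mappingCone.snd φ).v j j (add_zero j)) y) :
    Hom.lin ((mappingCone φ).d i j) (Hom.lin ((mappingCone.inl φ).v j i (by lia)) x) = y := by
  rw [← lin_comp, mappingCone.inl_v_d φ j i k (by lia) (by lia), lin_sub, lin_comp, lin_comp, hφx,
    hx, map_neg, sub_neg_eq_add, add_comm, ← lin_comp, ← lin_comp, ← lin_add,
    mappingCone.id_X φ j k hjk, lin_id]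

theorem isQuasiIso_of_d_eq_zero (hG : ∀ i j, G.d i j = 0)
    (hinj : ∀ j k l, j + 1 = k → k + 1 = l →
      HasBddLifts (F.d j k) {a | Hom.lin (F.d k l) a = 0 ∧ Hom.lin (φ.f k) a = 0})
    (hsurj : ∀ j k, j + 1 = k → ∃ C : ℝ≥0, ∀ b, ∃ z, Hom.lin (F.d j k) z = 0 ∧
      Hom.lin (φ.f j) z = b ∧ ‖z‖ ≤ C * ‖b‖) : IsQuasiIso φ := by
  intro i j k hij hjk
  obtain ⟨C, hC⟩ := hinj j k (k + 1) hjk rfl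
  obtain ⟨D, hD⟩ := hsurj j k hjk
  set p := (mappingCone.fst φ).1.v j k hjk
  set q := (mappingCone.snd φ).v j j (add_zero j)
  set ι := (mappingCone.inl φ).v j i (by lia)
  obtain ⟨P, hP⟩ := Hom.isBdd p
  obtain ⟨Q, hQ⟩ := Hom.isBdd q
  obtain ⟨I, hI⟩ := Hom.isBdd ι
  obtain ⟨Φ, hΦ⟩ := Hom.isBdd (φ.f j)
  refine strictlyExactAt_iff.2 ⟨HomologicalComplex.d_comp_d _ _ _ _,
    I * (D * (Q + Φ * (C * P)) + C * P), fun y hy => ?_⟩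
  obtain ⟨x, hx, hxC⟩ := hC _ (lin_fst_mem_of_mappingCone_cycle (hG j k) hjk rfl hy)
  obtain ⟨z, hz, hφz, hzD⟩ := hD (Hom.lin q y + Hom.lin (φ.f j) x)
  refine ⟨Hom.lin ι (z - x), mappingCone_d_inl_eq hij hjk ?_ ?_, ?_⟩
  · rw [map_sub, hz, hx, zero_sub]
  · rw [map_sub, hφz, add_sub_cancel_right]
  · calc _ ≤ I * ‖z - x‖ := hI _
      _ ≤ I * (D * (Q * ‖y‖ + Φ * (C * (P * ‖y‖))) + C * (P * ‖y‖)) := by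
        have hxy : ‖x‖ ≤ C * (P * ‖y‖) := hxC.trans (by gcongr; exact hP y)
        gcongr
        refine norm_sub_le_of_le (hzD.trans ?_) hxy
        gcongr
        exact norm_add_le_of_le (hQ y) ((hΦ x).trans (by gcongr))
      _ = _ := by push_cast; ring

end Cone

section Extend

variable {T : ChainComplex (BanMod 𝒞 A) ℕ} {Q : BanMod 𝒞 A}
  {φ : T ⟶ (ChainComplex.single₀ (BanMod 𝒞 A)).obj Q}

theorem isZero_extend_X_of_pos {j : ℤ} (hj : 0 < j) :
    IsZero ((T.extend ComplexShape.embeddingDownNat).X j) :=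
  T.isZero_extend_X _ j fun i (hi : -(i : ℤ) = j) => by omega

theorem hasBddLifts_extend_d
    (h : ∀ n, StrictlyExactAt (T.d (n + 2) (n + 1)) (T.d (n + 1) n))
    (h₀ : StrictlyExactAt (T.d 1 0) (φ.f 0)) {j k l : ℤ} (hjk : j + 1 = k) (hkl : k + 1 = l) :
    HasBddLifts ((T.extend ComplexShape.embeddingDownNat).d j k)
      {a | Hom.lin ((T.extend ComplexShape.embeddingDownNat).d k l) a = 0 ∧
        Hom.lin ((HomologicalComplex.extendMap φ ComplexShape.embeddingDownNat).f k) a = 0} := by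
  set e := ComplexShape.embeddingDownNat
  have he : ∀ n : ℕ, e.f n = -(n : ℤ) := fun _ => rfl
  obtain hk | hk := lt_or_ge 0 k
  · exact ⟨0, fun y _ => ⟨0, eq_of_isZero (isZero_extend_X_of_pos hk) _ _, by simp⟩⟩
  obtain ⟨n, rfl⟩ := Int.exists_eq_neg_ofNat hk
  have hj : e.f (n + 1) = j := by rw [he]; omega
  cases n with
  | zero =>
    have h := h₀.of_iso (T.extendXIso e hj) (T.extendXIso e rfl)
      (HomologicalComplex.extendXIso _ e rfl)
    rw [← HomologicalComplex.extendMap_f, ← HomologicalComplex.extend_d_eq] at h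
    exact h.hasBddLifts.mono fun y hy => hy.2
  | succ n =>
    have hl : e.f n = l := by rw [he]; omega
    have h := (h n).of_iso (T.extendXIso e hj) (T.extendXIso e rfl) (T.extendXIso e hl)
    rw [← HomologicalComplex.extend_d_eq, ← HomologicalComplex.extend_d_eq] at h
    exact h.hasBddLifts.mono fun y hy => hy.1

theorem exists_cycle_extendMap (hs : HasBddLifts (φ.f 0) Set.univ) {j k : ℤ} (hjk : j + 1 = k) :
    ∃ C : ℝ≥0, ∀ b, ∃ z, Hom.lin ((T.extend ComplexShape.embeddingDownNat).d j k) z = 0 ∧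
      Hom.lin ((HomologicalComplex.extendMap φ ComplexShape.embeddingDownNat).f j) z = b ∧
      ‖z‖ ≤ C * ‖b‖ := by
  set e := ComplexShape.embeddingDownNat
  obtain rfl | hj := eq_or_ne j 0
  · have he : e.f 0 = 0 := Int.neg_zero
    obtain ⟨C, hC⟩ := hs.of_iso (T.extendXIso e he) (HomologicalComplex.extendXIso _ e he)
    rw [← HomologicalComplex.extendMap_f] at hC
    refine ⟨C, fun b => ?_⟩
    obtain ⟨z, hz, hzC⟩ := hC b (Set.mem_univ _)
    exact ⟨z, eq_of_isZero (isZero_extend_X_of_pos (by omega)) _ _, hz, hzC⟩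
  · have hzero := (HomologicalComplex.isZero_single_obj_X (ComplexShape.up ℤ) 0 Q j hj).of_iso
      ((HomologicalComplex.eval _ _ j).mapIso
        (HomologicalComplex.extendSingleIso e Q 0 0 Int.neg_zero))
    exact ⟨0, fun b => ⟨0, map_zero _, eq_of_isZero hzero _ _, by simp⟩⟩

theorem isIso_toDMinus_map
    (h : ∀ n, StrictlyExactAt (T.d (n + 2) (n + 1)) (T.d (n + 1) n))
    (h₀ : StrictlyExactAt (T.d 1 0) (φ.f 0)) (hs : HasBddLifts (φ.f 0) Set.univ) :
    IsIso ((toDMinus 𝒞 A).map φ) :=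
  Localization.inverts (quasiIsos 𝒞 A).Q (quasiIsos 𝒞 A) ((toKMinus 𝒞 A).map φ)
    ⟨HomologicalComplex.extendMap φ ComplexShape.embeddingDownNat,
      isQuasiIso_of_d_eq_zero (HomologicalComplex.extend_single_d _ _ _)
        (fun _ _ _ => hasBddLifts_extend_d h h₀) fun _ _ => exists_cycle_extendMap hs, rfl⟩

end Extend

end QuasiIso

/-! ## Derived tensor products with flat cyclic modules -/

section DerivedTensor

open BanMod

variable {𝒞 : Ambient} {A : Type u} [NormedCommRing A] [Ultra 𝒞 A] {M N : BanMod 𝒞 A}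

theorem columnsExact_resolution (M N : BanMod 𝒞 A) :
    ColumnsExact (resolution M) (resolution N) (augmentation N) where
  succ i j := (strictlyExactAt_resolution N j).free_tensor (isStrict_resolution_d N j) (syzygy M i)
  zero i := (strictlyExactAt_augmentation N).free_tensor (isStrict_augmentation N) (syzygy M i)
  surj i := by
    have h := (strictlyExactAt_zero_iff (P := N).2 (hasBddLifts_augmentation N)).free_tensor
      isStrict_zero (syzygy M i)
    rw [tensorMap_zero] at h
    exact strictlyExactAt_zero_iff.1 h

theorem totι_totTensorDesc {L : BanMod 𝒞 A} (μ : tensor M N ⟶ L) :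
    totι (resolution M) (resolution N) 0 0 0 rfl ≫ totTensorDesc μ =
      tensorMap (augmentation M) (augmentation N) ≫ μ :=
  HomologicalComplex.ι_mapBifunctorDesc (K₁ := resolution M) (K₂ := resolution N)
    (F := tensorFunctor 𝒞 A) (c := ComplexShape.down ℕ) (fun i j _ => totTensorComponent μ i j)
    0 0 rfl

theorem totAug_comp_eq_totTensorDesc {L : BanMod 𝒞 A} (μ : tensor M N ⟶ L) :
    totAug (resolution M) (augmentation N) 0 ≫ tensorMap (augmentation M) (𝟙 N) ≫ μ =
      totTensorDesc μ := by
  refine tot_hom_ext fun i j hij => ?_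
  obtain ⟨rfl, rfl⟩ : i = 0 ∧ j = 0 := by omega
  rw [totι_totTensorDesc, totAug, Category.assoc, ← Category.assoc, totι_totπ, Category.id_comp,
    ← Category.assoc, tensorMap_comp, Category.id_comp, Category.comp_id]

theorem hasBddLifts_totTensorDesc {e : N} {μ : tensor M N ⟶ M}
    (hμ : ∀ x, Hom.lin μ (tmul x e) = x) : HasBddLifts (totTensorDesc μ) Set.univ := by
  obtain ⟨C, hC⟩ := hasBddLifts_augmentation M
  obtain ⟨_, hN⟩ := hasBddLifts_augmentation N
  obtain ⟨q, hq, -⟩ := hN e trivial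
  obtain ⟨I, hI⟩ := Hom.isBdd (totι (resolution M) (resolution N) 0 0 0 rfl)
  refine ⟨I * C * ‖q‖₊, fun y _ => ?_⟩
  obtain ⟨p, hp, hpC⟩ := hC y trivial
  refine ⟨Hom.lin (totι (resolution M) (resolution N) 0 0 0 rfl) (tmul p q), ?_, ?_⟩
  · rw [← lin_comp, totι_totTensorDesc, lin_comp, tensorMap_tmul, hp, hq, hμ]
  · calc _ ≤ I * (‖p‖ * ‖q‖) := (hI _).trans (by gcongr; exact norm_tmul_le _ _)
      _ ≤ I * ((C * ‖y‖) * ‖q‖) := by gcongr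
      _ = _ := by push_cast; ring

theorem BanMod.IsFlatGenerator.isIso_derivedTensorMap {e : N} (h : IsFlatGenerator e)
    {μ : tensor M N ⟶ M} (hμ : ∀ x, Hom.lin μ (tmul x e) = x) : IsIso (derivedTensorMap μ) := by
  have hf : (totTensorMap μ).f 0 = totTensorDesc μ :=
    ChainComplex.toSingle₀Equiv_symm_apply_f_zero _ _
  have hrow : StrictlyExactAt (tensorMap ((resolution M).d 1 0) (𝟙 N))
      (tensorMap (augmentation M) (𝟙 N) ≫ μ) :=
    h.strictlyExactAt_tensorMap_of_tmul (strictlyExactAt_augmentation M) (isStrict_augmentation M)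
      fun p => by rw [lin_comp, tensorMap_tmul, lin_id, hμ]
  refine isIso_toDMinus_map (fun n => ?_) ?_ ?_
  · exact (columnsExact_resolution M N).strictlyExactAt_tot_succ n
      (h.strictlyExactAt_tensorMap (strictlyExactAt_resolution M n) (isStrict_resolution_d M n))
  · rw [hf, ← totAug_comp_eq_totTensorDesc]
    exact (columnsExact_resolution M N).strictlyExactAt_tot_zero hrow
  · rw [hf]
    exact hasBddLifts_totTensorDesc hμ

end DerivedTensor

namespace BanAlg

open BanMod Filter Topology

theorem isHomotopyEpi_of_approxUnit_ker {𝒞 : Ambient} {R : Type v} [NormedCommRing R]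
    {A B : BanAlg.{u} 𝒞 R} (π : A ⟶ B)
    (hlift : ∃ C : ℝ≥0, ∀ b : B, ∃ a : A, Hom.alg π a = b ∧ ‖a‖ ≤ C * ‖b‖)
    (hker : ∃ (D : ℝ≥0) (l : Filter A), l.NeBot ∧ (∀ᶠ u in l, Hom.alg π u = 1 ∧ ‖u‖ ≤ D) ∧
      ∀ i, Hom.alg π i = 0 → Tendsto (fun u => u * i) l (𝓝 0)) : IsHomotopyEpi π := by
  let e : asModule π := (1 : B)
  have hsmul (a : A) : a • e = Hom.alg π a := mul_one (M := B) _
  have he : IsFlatGenerator e := by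
    obtain ⟨C, hC⟩ := hlift
    obtain ⟨D, l, hl, hu, hi⟩ := hker
    refine ⟨⟨C, fun b => ?_⟩, D, l, hl, ?_, fun i hie => hi i ((hsmul i).symm.trans hie)⟩
    · obtain ⟨a, hab, ha⟩ := hC b
      exact ⟨a, (hsmul a).trans hab, ha⟩
    · filter_upwards [hu] with u ⟨h1, hD⟩ using ⟨(hsmul u).trans h1, hD⟩
  exact he.isIso_derivedTensorMap fun x =>
    (tensorLift_tmul (M := asModule π) (N := asModule π) (P := asModule π) _ _ x e).trans
      (mul_one (M := B) x)

end BanAlg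

/-! ## Algebras of continuous functions -/

section Functions

open Filter Topology TopologicalSpace

/-- Continuous functions on closed subsets of `X` with values in `E` extend to `X`, the norm of the
extension being bounded by a constant, independent of the subset, times that of the function. -/
def HasBddExtension (X : Type u) [TopologicalSpace X] [CompactSpace X] (E : Type v)
    [SeminormedAddCommGroup E] : Prop :=
  ∃ C : ℝ≥0, ∀ (K : Closeds X) (f : C(K, E)), ∃ g : C(X, E), g.restrict K = f ∧ ‖g‖ ≤ C * ‖f‖

variable {X : Type u} [TopologicalSpace X] [CompactSpace X]

theorem HasBddExtension.exists_eq_one_eq_zero {R : Type v} [SeminormedRing R] [NormOneClass R]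
    (h : HasBddExtension X R) :
    ∃ C : ℝ≥0, ∀ S T : Set X, IsClosed S → IsClosed T → Disjoint S T →
      ∃ g : C(X, R), (∀ x ∈ S, g x = 1) ∧ (∀ x ∈ T, g x = 0) ∧ ‖g‖ ≤ C := by
  obtain ⟨C, hC⟩ := h
  refine ⟨C, fun S T hS hT hST => ?_⟩
  let K : Closeds X := ⟨S ∪ T, hS.union hT⟩
  let S' : Set K := Subtype.val ⁻¹' S
  have hS' : IsClopen S' := by
    refine ⟨hS.preimage continuous_subtype_val, ?_⟩
    convert hT.isOpen_compl.preimage (continuous_subtype_val (p := (· ∈ K))) using 1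
    ext ⟨x, hx⟩
    exact ⟨fun h => Set.disjoint_left.1 hST h, hx.resolve_right⟩
  obtain ⟨g, hg, hgC⟩ := hC K ⟨S'.indicator 1, continuous_one.indicator (by simp [hS'.frontier_eq])⟩
  have hgK (x : K) : g x = S'.indicator 1 x := DFunLike.congr_fun hg x
  refine ⟨g, fun x hx => ?_, fun x hx => ?_, hgC.trans ?_⟩
  · exact (hgK ⟨x, .inl hx⟩).trans (Set.indicator_of_mem (show _ ∈ S' from hx) _)
  · exact (hgK ⟨x, .inr hx⟩).trans
      (Set.indicator_of_notMem (show _ ∉ S' from Set.disjoint_right.1 hST hx) _)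
  · refine mul_le_of_le_one_right C.2 ((ContinuousMap.norm_le _ zero_le_one).2 fun x => ?_)
    exact (norm_indicator_le_norm_self (1 : K → R) x).trans_eq norm_one

theorem HasBddExtension.exists_approxUnit {R : Type v} [SeminormedRing R] [NormOneClass R]
    (h : HasBddExtension X R) (K : Closeds X) :
    ∃ (D : ℝ≥0) (l : Filter C(X, R)), l.NeBot ∧
      (∀ᶠ u in l, (∀ x ∈ K, u x = 1) ∧ ‖u‖ ≤ D) ∧
      ∀ i : C(X, R), (∀ x ∈ K, i x = 0) → Tendsto (fun u => u * i) l (𝓝 0) := by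
  obtain ⟨D, hD⟩ := h.exists_eq_one_eq_zero
  let B (U : Set X) : Set C(X, R) := {u | (∀ x ∈ K, u x = 1) ∧ ‖u‖ ≤ D ∧ ∀ x ∉ U, u x = 0}
  have hB : Monotone B := fun U V hUV u hu =>
    ⟨hu.1, hu.2.1, fun x hx => hu.2.2 x fun hxU => hx (hUV hxU)⟩
  refine ⟨D, (𝓝ˢ (K : Set X)).lift' B, (lift'_neBot_iff hB).2 fun U hU => ?_, ?_, fun i hi => ?_⟩
  · obtain ⟨V, hV, hKV, hVU⟩ := mem_nhdsSet_iff_exists.1 hU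
    obtain ⟨u, hu1, hu0, huD⟩ := hD K Vᶜ K.isClosed hV.isClosed_compl
      (Set.disjoint_compl_right_iff_subset.2 hKV)
    exact ⟨u, hu1, huD, fun x hx => hu0 x fun hxV => hx (hVU hxV)⟩
  · filter_upwards [mem_lift' univ_mem] with u hu using ⟨hu.1, hu.2.1⟩
  · refine Metric.nhds_basis_closedBall.tendsto_right_iff.2 fun ε hε => ?_
    obtain ⟨δ, hδ, hδε⟩ := exists_pos_mul_le D hε
    have hU : {x | ‖i x‖ < δ} ∈ 𝓝ˢ (K : Set X) :=
      (isOpen_lt (by fun_prop) continuous_const).mem_nhdsSet.2 fun x hx => by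
        simpa [hi x hx] using hδ
    filter_upwards [mem_lift' hU] with u hu
    obtain ⟨-, huD, hu0⟩ := hu
    refine mem_closedBall_zero_iff.2 ((ContinuousMap.norm_le _ hε.le).2 fun x => ?_)
    by_cases hx : ‖i x‖ < δ
    · calc ‖u x * i x‖ ≤ ‖u x‖ * ‖i x‖ := norm_mul_le _ _
        _ ≤ D * δ := by gcongr; exact (u.norm_coe_le_norm x).trans huD
        _ ≤ ε := hδε
    · rw [ContinuousMap.mul_apply, hu0 x hx, zero_mul, norm_zero]
      exact hε.le

theorem HasBddExtension.isHomotopyEpi_restriction {R : Type v} [NormedField R] [CompleteSpace R]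
    (h : HasBddExtension X R) (𝒞 : Ambient) [Ultra 𝒞 R] (K : Closeds X) :
    BanAlg.IsHomotopyEpi (restriction 𝒞 R K) := by
  obtain ⟨D, l, hl, hu, hi⟩ := h.exists_approxUnit K
  refine BanAlg.isHomotopyEpi_of_approxUnit_ker _ ?_
    ⟨D, l, hl, hu.mono fun u hu => ⟨ContinuousMap.ext fun x => hu.1 x x.2, hu.2⟩, fun i hiK => ?_⟩
  · exact h.imp fun C hC => hC K
  · exact hi i fun x hx => DFunLike.congr_fun (F := C(K, R)) hiK ⟨x, hx⟩

theorem hasBddExtension_of_isometry_rclike [T2Space X] {E : Type v} [SeminormedAddCommGroup E]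
    {𝕜 : Type*} [RCLike 𝕜] (e : E ≃+ 𝕜) (he : ∀ x, ‖e x‖ = ‖x‖) : HasBddExtension X E := by
  have hsymm (t : 𝕜) : ‖e.symm t‖ = ‖t‖ := by rw [← he, e.apply_symm_apply]
  have hc : Continuous e := (AddMonoidHomClass.isometry_of_norm e he).continuous
  have hc' : Continuous e.symm := (AddMonoidHomClass.isometry_of_norm e.symm hsymm).continuous
  refine ⟨1, fun K f => ?_⟩
  have : CompactSpace (K : Set X) := inferInstanceAs (CompactSpace K)
  obtain ⟨g, hgf, hg⟩ := BoundedContinuousFunction.exists_norm_eq_domRestrict_eq K.isClosed 𝕜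
    (BoundedContinuousFunction.mkOfCompact ⟨e ∘ f, hc.comp f.continuous⟩)
  refine ⟨⟨e.symm ∘ g, hc'.comp g.continuous⟩, ContinuousMap.ext fun x => ?_, ?_⟩
  · exact (congrArg e.symm (DFunLike.congr_fun hg x)).trans (e.symm_apply_apply (f x))
  · rw [NNReal.coe_one, one_mul, ContinuousMap.norm_le _ (norm_nonneg _)]
    intro x
    refine (hsymm (g x)).trans_le ((g.norm_coe_le_norm x).trans (hgf.trans_le ?_))
    exact (ContinuousMap.norm_le _ (norm_nonneg _)).2 fun y =>
      (he (f y)).trans_le (f.norm_coe_le_norm y)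

theorem exists_continuousMap_eq_of_isClopen {Y ι E : Type*} [TopologicalSpace Y] [Finite ι]
    [AddCommMonoid E] [TopologicalSpace E] [ContinuousAdd E] {U : ι → Set Y}
    (hU : ∀ i, IsClopen (U i)) (hdisj : Set.univ.PairwiseDisjoint U) (v : ι → E) :
    ∃ g : C(Y, E), (∀ i, ∀ x ∈ U i, g x = v i) ∧ ∀ x, (∀ i, x ∉ U i) → g x = 0 := by
  have := Fintype.ofFinite ι
  refine ⟨⟨fun x => ∑ i, (U i).indicator (fun _ => v i) x, continuous_finsetSum _ fun i _ =>
    continuous_const.indicator (by simp [(hU i).frontier_eq])⟩, fun i x hx => ?_, fun x hx => ?_⟩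
  · refine (Fintype.sum_eq_single i fun j hji => ?_).trans (Set.indicator_of_mem hx _)
    exact Set.indicator_of_notMem (Set.disjoint_right.1 (hdisj trivial trivial hji) hx) _
  · exact Finset.sum_eq_zero fun i _ => Set.indicator_of_notMem (hx i) _

theorem exists_norm_restrict_sub_le [T2Space X] [TotallyDisconnectedSpace X] {E : Type v}
    [SeminormedAddCommGroup E] (K : Closeds X) (f : C(K, E)) {ε : ℝ} (hε : 0 < ε) :
    ∃ g : C(X, E), ‖g‖ ≤ ‖f‖ ∧ ‖f - g.restrict K‖ ≤ ε := by
  obtain ⟨n, D, hD, hDε, hDcover, hDdisj⟩ :=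
    f.exists_disjoint_nonempty_clopen_cover_of_mem_nhds_diagonal
      (nhdsSet_diagonal_le_uniformity (Metric.dist_mem_uniformity hε))
  have hDne (i) : ∃ x, x ∈ D i := by
    by_contra! h
    exact hD i (SetLike.coe_injective (Set.eq_empty_of_forall_notMem h))
  choose r hr using hDne
  obtain ⟨C, hC, hDC, -, -, hCdisj⟩ := exists_clopen_partition_of_clopen_cover
    (Z := fun i => Subtype.val '' (D i : Set K)) (D := fun _ => Set.univ)
    (fun i => K.isClosed.isClosedMap_subtype_val _ (D i).isClopen.isClosed)
    (fun _ => isClopen_univ) (fun _ => Set.subset_univ _) fun i _ j _ hij =>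
      (Set.disjoint_image_iff Subtype.val_injective).2 (Clopens.coe_disjoint.2 (hDdisj hij))
  obtain ⟨g, hg, hg0⟩ := exists_continuousMap_eq_of_isClopen hC hCdisj fun i => f (r i)
  refine ⟨g, (ContinuousMap.norm_le _ (norm_nonneg f)).2 fun x => ?_,
    (ContinuousMap.norm_le _ hε.le).2 fun x => ?_⟩
  · by_cases hx : ∃ i, x ∈ C i
    · obtain ⟨i, hi⟩ := hx
      exact (congrArg norm (hg i x hi)).trans_le (f.norm_coe_le_norm _)
    · simp [hg0 x fun i hi => hx ⟨i, hi⟩]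
  · obtain ⟨i, hi⟩ := Set.mem_iUnion.1 (hDcover (Set.mem_univ x))
    have hgx : g x = f (r i) := hg i x (hDC i ⟨x, hi, rfl⟩)
    change ‖f x - g x‖ ≤ ε
    rw [hgx, ← dist_eq_norm]
    exact (hDε i x hi (r i) (hr i)).le

theorem hasBddExtension_of_totallyDisconnectedSpace [T2Space X] [TotallyDisconnectedSpace X]
    {E : Type v} [NormedAddCommGroup E] [CompleteSpace E] : HasBddExtension X E := by
  refine ⟨2, fun K f => ?_⟩
  let res : C(X, E) →+ C(K, E) :=
    { toFun := fun g => g.restrict K, map_zero' := rfl, map_add' := fun _ _ => rfl }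
  have happrox (y : C(K, E)) : ∃ x, ‖x‖ ≤ 1 * ‖y‖ ∧ ‖y - res x‖ ≤ ‖y‖ / 2 := by
    obtain rfl | hy := eq_or_ne y 0
    · exact ⟨0, by simp⟩
    · obtain ⟨x, hx, hxy⟩ := exists_norm_restrict_sub_le K y (half_pos (norm_pos_iff.2 hy))
      exact ⟨x, hx.trans_eq (one_mul _).symm, hxy⟩
  obtain ⟨g, hg, hgf⟩ := exists_preimage_of_approx_preimage res
    (ContinuousMap.continuous_restrict _) zero_le_one happrox f
  exact ⟨g, hg, by simpa using hgf⟩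

end Functions

end BanachGeometry

theorem mainTheorem1_general (𝒞 : BanachGeometry.Ambient)
    (X : Type u) [TopologicalSpace X] [CompactSpace X] [T2Space X]
    (R : Type v) [NormedField R] [CompleteSpace R] [BanachGeometry.Ultra 𝒞 R]
    (h : BanachGeometry.IsAdmissiblePair .arch R ∨ TotallyDisconnectedSpace X)
    (K : TopologicalSpace.Closeds X) :
    BanachGeometry.BanAlg.IsHomotopyEpi (BanachGeometry.restriction 𝒞 R K) := by
  refine BanachGeometry.HasBddExtension.isHomotopyEpi_restriction ?_ 𝒞 K
  obtain (⟨e, he⟩ | ⟨e, he⟩) | _ := h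
  · exact BanachGeometry.hasBddExtension_of_isometry_rclike e.toAddEquiv he
  · exact BanachGeometry.hasBddExtension_of_isometry_rclike e.toAddEquiv he
  · exact BanachGeometry.hasBddExtension_of_totallyDisconnectedSpace

theorem mainTheorem1 (𝒞 : BanachGeometry.Ambient)
    (X : Type u) [TopologicalSpace X] [CompactSpace X] [T2Space X]
    (R : Type v) [NormedField R] [CompleteSpace R] [BanachGeometry.Ultra 𝒞 R]
    (h : BanachGeometry.IsAdmissibleTriple 𝒞 X R) (K : TopologicalSpace.Closeds X) :
    BanachGeometry.BanAlg.IsHomotopyEpi (BanachGeometry.restriction 𝒞 R K) := by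
  refine mainTheorem1_general 𝒞 X R ?_ K
  cases 𝒞 with
  | arch => exact .inl h.1
  | nonarch => exact .inr (h.2 rfl)
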